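/- Let $\mathcal A=(Q,\Sigma,q_0,\Delta,F)$ be a nondeterministic Büchi automaton with finite state set $Q$, $n=|Q|$, alphabet $\Sigma$ and transition function $\Delta:Q\times\Sigma\to 2^Q$, and let $k\ge 1$ be an integer. For $X\subseteq Q$ put $\Delta(X,a)=\bigcup_{q\in X}\Delta(q,a)$. A run on $a_1a_2\cdots\in\Sigma^\omega$ is a sequence $q_0q_1\cdots$ starting in the initial state with $q_i\in\Delta(q_{i-1},a_i)$ for all $i\ge 1$; it is (Büchi) accepting if it visits $F$ infinitely often, and $L(\mathcal A)$ is the set of words that have an accepting run. **Width.** In the game $\mathcal G_w(\mathcal A,k)$, positions are sets of at most $k$ states and $X_0=\{q_0\}$; in round $i$ Player 1 chooses a letter $a_{i+1}$ and Player 0 chooses $X_{i+1}\subseteq\Delta(X_i,a_{i+1})$ with $|X_{i+1}|\le k$. Player 0 wins an infinite play if, whenever $a_1a_2\cdots\in L(\mathcal A)$, there is an accepting run $q_0q_1\cdots$ of $\mathcal A$ on $a_1a_2\cdots$ with $q_i\in X_i$ for all $i$. Then $\mathrm{width}(\mathcal A)$ is the least $k\ge 1$ such that Player 0 has a winning strategy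 in $\mathcal G_w(\mathcal A,k)$. **Good-for-games.** An automaton on infinite words with state set $S$ is GFG if there is $f:\Sigma^*\to S$ such that for every word $a_1a_2\cdots$ the sequence $f(\varepsilon)f(a_1)f(a_1a_2)\cdots$ is a run on it, which is accepting whenever the word is in the language of the automaton. **The $k$-Safra construction.** $\mathcal A_k$ is the following nondeterministic Rabin automaton. A state consists of a finite ordered rooted tree with node set $V$ and root $v_r$, a map $\sigma:V\to 2^Q$, a colouring $\chi:V\to\{\mathit{Green},\mathit{White}\}$ and an injective labelling $\lambda:V\to\{l_1,\dots,l_{2n}\}$ such that: for each $v$ with at least one child the union of the sets $\sigma(v')$ over the children $v'$ of $v$ is a proper subset of $\sigma(v)$; $\sigma(v)\cap\sigma(v')=\emptyset$ if neither of $v,v'$ is an ancestor of the other; $\sigma(v)\ne\emptyset$ for $v\neq v_r$; and $|\sigma(v)|\le k$ for all $v$. (It follows that $|V|\le n$.) Trees are considered up to isomorphism preserving all this data. In the initial state the root is the only node, with set $\{q_0\}$, colour $\mathit{White}$ and label $l_1$. The transitions on reading $a$ are obtained as follows. 1. Every node $v$ with $\sigma(v)\cap F\neq\emptyset$ gets a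 new right-most child, with set $\sigma(v)\cap F$ and a new label; the labels of the new nodes are pairwise distinct, are not used in the current state, and are given by an arbitrary fixed rule depending on the current state. 2. Let $D=\Delta(\sigma(v_r),a)$. A set $X$ is chosen nondeterministically: $X=D$ if $|D|\le k$, and otherwise any $X\subseteq D$ with $|X|=k$. The set of the root becomes $X$, and the set $Y$ of any other node becomes $\Delta(Y,a)\cap X$. 3. A state $s$ is removed from the set of $v'$ if it is also in the set of a node $v$ to the left of $v'$, that is, $v$ and $v'$ are in the subtrees rooted at children $u_1$ and $u_2$ of a common node, with $u_1$ to the left of $u_2$. 4. All nodes other than the root whose set is empty are removed. 5. Every node that has at least one child and whose set equals the union of the sets of its children becomes $\mathit{Green}$ and loses all its proper descendants; all other nodes become $\mathit{White}$. A run of $\mathcal A_k$ is accepting if for some $i\in\{1,\dots,2n\}$ infinitely many of its states contain a green node with label $l_i$ and only finitely many of its states contain no node with label $l_i$. **Claim.** For every $k\ge 1$ and every such rule for the labels of new nodes, $L(\mathcal A_k)=L(\mathcal A)$, and $\mathrm{width}(\mathcal A)\le k$ if and only if $\mathcal A_k$ is GFG. -/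

import Mathlib

namespace KSafra

open Filter

/-! ### Automata on infinite words -/

/-- A nondeterministic automaton on infinite words with set of states `Q`, alphabet `α` and an
arbitrary acceptance condition, given as the set of accepted sequences of states.  The infinite
word `a₁a₂a₃…` is represented by `w : ℕ → α` with `w i = a_{i+1}`. -/
structure OmegaAutomaton (Q : Type*) (α : Type*) where
  start : Q
  Δ : Q → α → Set Q
  Acc : Set (ℕ → Q)

namespace OmegaAutomaton

variable {Q α : Type*}

def IsRun (A : OmegaAutomaton Q α) (w : ℕ → α) (ρ : ℕ → Q) : Prop :=
  ρ 0 = A.start ∧ ∀ i, ρ (i + 1) ∈ A.Δ (ρ i) (w i)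

def IsAcceptingRun (A : OmegaAutomaton Q α) (w : ℕ → α) (ρ : ℕ → Q) : Prop :=
  A.IsRun w ρ ∧ ρ ∈ A.Acc

/-- The language recognised by the automaton. -/
def lang (A : OmegaAutomaton Q α) : Set (ℕ → α) :=
  {w | ∃ ρ, A.IsAcceptingRun w ρ}

/-- The finite prefix `a₁…aᵢ` of an infinite word. -/
def takePrefix (w : ℕ → α) (i : ℕ) : List α := (List.range i).map w

/-- Good-for-games: some strategy `f : α* → Q` resolves the nondeterminism online. -/
def IsGFG (A : OmegaAutomaton Q α) : Prop :=
  ∃ f : List α → Q, ∀ w : ℕ → α,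
    A.IsRun w (fun i => f (takePrefix w i)) ∧
    (w ∈ A.lang → A.IsAcceptingRun w (fun i => f (takePrefix w i)))

end OmegaAutomaton

/-- A nondeterministic Büchi automaton. -/
structure NBA (Q : Type*) (α : Type*) where
  start : Q
  Δ : Q → α → Finset Q
  F : Finset Q

/-- The Büchi condition: infinitely many accepting states. -/
def NBA.toOmega {Q α : Type*} (A : NBA Q α) : OmegaAutomaton Q α where
  start := A.start
  Δ := fun q a => ↑(A.Δ q a)
  Acc := {ρ | ∃ᶠ i in atTop, ρ i ∈ A.F}

/-- A nondeterministic Rabin automaton with a family of pairs `(G i, B i)` indexed by `ι`. -/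
structure NRA (S : Type*) (α : Type*) (ι : Type*) where
  start : S
  Δ : S → α → Set S
  G : ι → Set S
  B : ι → Set S

/-- The Rabin condition: for some `i`, infinitely many states from `G i` and finitely many
states from `B i`. -/
def NRA.toOmega {S α ι : Type*} (A : NRA S α ι) : OmegaAutomaton S α where
  start := A.start
  Δ := A.Δ
  Acc := {ρ | ∃ i, (∃ᶠ m in atTop, ρ m ∈ A.G i) ∧ (∀ᶠ m in atTop, ρ m ∉ A.B i)}

/-! ### Games and width -/

/-- A game of infinite duration between players `0` and `1`; `P0` is the set of positions of
Player `0`, its complement the set of positions of Player `1`, and `W` is the set of sequences of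
positions that are winning for Player `0`. -/
structure Game (V : Type*) where
  P0 : Set V
  start : V
  E : V → V → Prop
  W : Set (ℕ → V)

namespace Game

variable {V : Type*}

def IsPlay (G : Game V) (π : ℕ → V) : Prop :=
  π 0 = G.start ∧ ∀ i, G.E (π i) (π (i + 1))

/-- A strategy for Player `0`: from the history and the current position, the next position. -/
structure Strategy0 (G : Game V) where
  move : List V → V → V
  edge : ∀ h, ∀ v ∈ G.P0, G.E v (move h v)

def Strategy0.Consistent {G : Game V} (τ : G.Strategy0) (π : ℕ → V) : Prop :=
  ∀ i, π i ∈ G.P0 → π (i + 1) = τ.move ((List.range i).map π) (π i)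

/-- Player `0` has a winning strategy. -/
def Player0Wins (G : Game V) : Prop :=
  ∃ τ : G.Strategy0, ∀ π, G.IsPlay π → τ.Consistent π → π ∈ G.W

end Game

/-- `Q^{≤ k}`: the sets of at most `k` states. -/
abbrev SubsetsLE (Q : Type*) (k : ℕ) := {X : Finset Q // X.card ≤ k}

/-- The width game with `k` tokens.  From `X` Player `1` chooses a letter `a`, which leads to the
intermediate position `(X, a)` of Player `0`, who moves to some `Y ⊆ Δ(X, a)` with at most `k`
elements.  A play `X₀ (X₀,a₁) X₁ (X₁,a₂) X₂ …` is winning for Player `0` if, whenever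
`a₁a₂…` is in the language, there is an accepting run `q₀q₁…` on it with `qᵢ ∈ Xᵢ` for all `i`. -/
def widthGame {Q α : Type*} (A : OmegaAutomaton Q α) (k : ℕ) (hk : 1 ≤ k) :
    Game (SubsetsLE Q k ⊕ (SubsetsLE Q k × α)) where
  P0 := Set.range Sum.inr
  start := Sum.inl ⟨{A.start}, by simpa using hk⟩
  E := fun v v' => match v, v' with
    | Sum.inl X, Sum.inr Ya => Ya.1 = X
    | Sum.inr Xa, Sum.inl Y => ∀ q ∈ Y.1, ∃ p ∈ Xa.1.1, q ∈ A.Δ p Xa.2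
    | _, _ => False
  W := {π | ∀ (X : ℕ → SubsetsLE Q k) (w : ℕ → α),
    (∀ i, π (2 * i) = Sum.inl (X i) ∧ π (2 * i + 1) = Sum.inr (X i, w i)) →
      w ∈ A.lang → ∃ ρ, A.IsAcceptingRun w ρ ∧ ∀ i, ρ i ∈ (X i).1}

/-- The width: the least `k ≥ 1` such that Player `0` wins the width game with `k` tokens.  For
an automaton with finitely many states such `k` exists, since `k = |Q|` is one. -/
noncomputable def OmegaAutomaton.width {Q α : Type*} (A : OmegaAutomaton Q α) : ℕ :=
  sInf {k | ∃ hk : 1 ≤ k, (widthGame A k hk).Player0Wins}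

/-! ### Safra trees -/

inductive Colour
  | Green
  | White

/-- The labels `l₁, …, l₂ₙ`, where `n = |Q|`; `lᵢ` is `i - 1`. -/
abbrev Label (Q : Type*) [Fintype Q] := Fin (2 * Fintype.card Q)

/-- The data `(T, σ, χ, λ)` with `T = (V, root, cl)` of a Safra tree.  In a Safra tree distinct
nodes carry distinct labels, so that up to renaming of nodes every node is its own label: `V` is
a set of labels and `λ` is the inclusion. -/
@[ext]
structure SafraTree (Q : Type*) [Fintype Q] where
  V : Finset (Label Q)
  root : Label Q
  /-- the list of children of a node, from left to right -/
  cl : Label Q → List (Label Q)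
  σ : Label Q → Finset Q
  χ : Label Q → Colour

namespace SafraTree

variable {Q : Type*} [Fintype Q]

def Child (t : SafraTree Q) (u v : Label Q) : Prop := v ∈ t.cl u

/-- `v` is in the subtree rooted at `u`. -/
def InSubtree (t : SafraTree Q) (u v : Label Q) : Prop := Relation.ReflTransGen t.Child u v

/-- `v` and `v'` are in the subtrees rooted at two children `u₁`, `u₂` of a common ancestor `u`,
where `u₁` is to the left of `u₂`. -/
def LeftOf (t : SafraTree Q) (v v' : Label Q) : Prop :=
  ∃ u u₁ u₂, List.Sublist [u₁, u₂] (t.cl u) ∧ t.InSubtree u₁ v ∧ t.InSubtree u₂ v'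

/-- The union of the sets associated with the children of `v`. -/
def childUnion [DecidableEq Q] (t : SafraTree Q) (v : Label Q) : Finset Q :=
  (t.cl v).toFinset.biUnion t.σ

/-- `(V, root, cl)` is an ordered rooted tree. -/
structure IsTree (t : SafraTree Q) : Prop where
  root_mem : t.root ∈ t.V
  child_mem : ∀ u v, t.Child u v → u ∈ t.V ∧ v ∈ t.V
  nodup : ∀ v, (t.cl v).Nodup
  root_not_child : ∀ u, ¬ t.Child u t.root
  parent_unique : ∀ u u' v, t.Child u v → t.Child u' v → u = u'
  reach : ∀ v ∈ t.V, t.InSubtree t.root v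

/-- The states of the `k`-Safra construction. -/
structure IsState [DecidableEq Q] (k : ℕ) (t : SafraTree Q) : Prop where
  tree : t.IsTree
  /-- `σ` and `χ` are functions on `V`; they carry a default value elsewhere -/
  off : ∀ v ∉ t.V, t.σ v = ∅ ∧ t.χ v = Colour.White
  ssubset : ∀ v ∈ t.V, t.cl v ≠ [] → t.childUnion v ⊂ t.σ v
  disjoint : ∀ v ∈ t.V, ∀ v' ∈ t.V, ¬ t.InSubtree v v' → ¬ t.InSubtree v' v →
    Disjoint (t.σ v) (t.σ v')
  nonempty : ∀ v ∈ t.V, t.σ v = ∅ → v = t.root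
  card_le : ∀ v ∈ t.V, (t.σ v).card ≤ k

open Classical in
/-- Remove all the nodes outside `S`. -/
noncomputable def restrict (t : SafraTree Q) (S : Finset (Label Q)) : SafraTree Q where
  V := t.V ∩ S
  root := t.root
  cl := fun v => if v ∈ S then (t.cl v).filter (· ∈ S) else []
  σ := fun v => if v ∈ S then t.σ v else ∅
  χ := fun v => if v ∈ S then t.χ v else Colour.White

end SafraTree

/-! ### The `k`-Safra construction -/

section Construction

variable {Q α : Type*} [Fintype Q] [DecidableEq Q]

/-- `Δ(X, a)`. -/
def NBA.post (A : NBA Q α) (X : Finset Q) (a : α) : Finset Q := X.biUnion (fun q => A.Δ q a)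

/-- A rule that fixes the labels of new nodes: if a new child is added to the node `v` of `t`, it
gets the label `fresh t v`.  These labels are pairwise distinct and not used in `t`. -/
structure LabelRule (Q : Type*) [Fintype Q] where
  fresh : SafraTree Q → Label Q → Label Q
  injOn : ∀ t, t.V.card ≤ Fintype.card Q → Set.InjOn (fresh t) t.V
  not_mem : ∀ t, t.V.card ≤ Fintype.card Q → ∀ v ∈ t.V, fresh t v ∉ t.V

/-- Such rules exist, as there are `2n` labels. -/
theorem LabelRule.exists_rule (Q : Type*) [Fintype Q] : Nonempty (LabelRule Q) := by
  classical
  have h : ∀ t : SafraTree Q, ∃ f : Label Q → Label Q, t.V.card ≤ Fintype.card Q →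
      Set.InjOn f t.V ∧ ∀ v ∈ t.V, f v ∉ t.V := by
    intro t
    by_cases ht : t.V.card ≤ Fintype.card Q
    · have hc : t.V.card ≤ (t.V)ᶜ.card := by
        rw [Finset.card_compl, Fintype.card_fin]; omega
      obtain ⟨e⟩ : Nonempty (t.V ↪ ((t.V)ᶜ : Finset (Label Q))) :=
        Function.Embedding.nonempty_of_card_le (by rw [Fintype.card_coe, Fintype.card_coe]; exact hc)
      refine ⟨fun v => if hv : v ∈ t.V then (e ⟨v, hv⟩ : Label Q) else v, fun _ => ⟨?_, ?_⟩⟩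
      · intro v hv v' hv' hvv
        have hv1 : v ∈ t.V := hv
        have hv2 : v' ∈ t.V := hv'
        simp only [hv1, hv2, dif_pos] at hvv
        simpa using e.injective (Subtype.ext hvv)
      · intro v hv
        simp only [hv, dif_pos]
        exact Finset.mem_compl.1 (e ⟨v, hv⟩).2
    · exact ⟨id, fun h => absurd h ht⟩
  choose f hf using h
  exact ⟨⟨f, fun t ht => (hf t ht).1, fun t ht => (hf t ht).2⟩⟩

namespace SafraTree

/-- Expansion: every node `v` with `σ(v) ∩ F ≠ ∅` gets a new right-most child `fr v`, to
which the set `σ(v) ∩ F` is associated. -/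
def expand (A : NBA Q α) (fr : Label Q → Label Q) (t : SafraTree Q) : SafraTree Q where
  V := t.V ∪ (t.V.filter (fun v => (t.σ v ∩ A.F).Nonempty)).image fr
  root := t.root
  cl := fun v => if v ∈ t.V ∧ (t.σ v ∩ A.F).Nonempty then t.cl v ++ [fr v] else t.cl v
  σ := fun v => if v ∈ t.V then t.σ v
    else (t.V.filter (fun p => fr p = v)).biUnion (fun p => t.σ p ∩ A.F)
  χ := t.χ

/-- The possible choices of the new set at the root, from its successor set `D = Δ(σ(root), a)`. -/
def rootChoices (k : ℕ) (D : Finset Q) : Set (Finset Q) :=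
  {X | if D.card ≤ k then X = D else X ⊆ D ∧ X.card = k}

/-- Local subset construction: the set `X` is chosen for the root and propagated down in the tree. -/
def advance (A : NBA Q α) (a : α) (X : Finset Q) (t : SafraTree Q) : SafraTree Q :=
  { t with σ := fun v => if v = t.root then X else A.post (t.σ v) a ∩ X }

open Classical in
/-- Horizontal merge: a state is removed from the set of `v` if it is also in the set of a node to the
left of `v`. -/
noncomputable def horizontal (t : SafraTree Q) : SafraTree Q :=
  { t with σ := fun v => (t.σ v).filter (fun s => ¬ ∃ v' ∈ t.V, t.LeftOf v' v ∧ s ∈ t.σ v') }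

/-- Cleaning: remove all the nodes with empty sets, except the root. -/
noncomputable def removeEmpty (t : SafraTree Q) : SafraTree Q :=
  t.restrict (t.V.filter (fun v => v = t.root ∨ (t.σ v).Nonempty))

/-- `v` has children and their sets cover the set of `v`. -/
def Full (t : SafraTree Q) (v : Label Q) : Prop :=
  v ∈ t.V ∧ t.cl v ≠ [] ∧ t.childUnion v = t.σ v

open Classical in
/-- Vertical merge: the nodes that are covered by their children become green and lose their children
(with the subtrees below them), all other nodes become white. -/
noncomputable def vertical (t : SafraTree Q) : SafraTree Q :=
  { t with χ := fun v => if t.Full v then Colour.Green else Colour.White }.restrict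
    (t.V.filter (fun v => ¬ ∃ u, t.Full u ∧ Relation.TransGen t.Child u v))

/-- The successor of `t` on reading `a`, where `X` is the set chosen for the root. -/
noncomputable def next (A : NBA Q α) (r : LabelRule Q) (t : SafraTree Q) (a : α)
    (X : Finset Q) : SafraTree Q :=
  ((((t.expand A (r.fresh t)).advance A a X).horizontal).removeEmpty).vertical

end SafraTree

/-- The label `l₁`. -/
def NBA.firstLabel (A : NBA Q α) : Label Q :=
  ⟨0, Nat.mul_pos two_pos (Fintype.card_pos_iff.2 ⟨A.start⟩)⟩

/-- The initial tree: a single white node with label `l₁` and set `{q₀}`. -/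
def NBA.startTree (A : NBA Q α) : SafraTree Q where
  V := {A.firstLabel}
  root := A.firstLabel
  cl := fun _ => []
  σ := fun v => if v = A.firstLabel then {A.start} else ∅
  χ := fun _ => Colour.White

theorem NBA.startTree_isState (A : NBA Q α) (k : ℕ) (hk : 1 ≤ k) : A.startTree.IsState k where
  tree := by
    constructor <;> simp [NBA.startTree, SafraTree.Child, SafraTree.InSubtree]
    exact Relation.ReflTransGen.refl
  off := by
    intro v hv
    have : v ≠ A.firstLabel := by simpa [NBA.startTree] using hv
    simp [NBA.startTree, this]
  ssubset := by simp [NBA.startTree]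
  disjoint := by
    intro v hv v' hv' h
    have h1 : v = A.firstLabel := by simpa [NBA.startTree] using hv
    have h2 : v' = A.firstLabel := by simpa [NBA.startTree] using hv'
    subst h1; subst h2
    exact absurd Relation.ReflTransGen.refl h
  nonempty := by simp [NBA.startTree]
  card_le := by simpa [NBA.startTree] using hk

/-- The `k`-Safra construction `A_k`, a nondeterministic Rabin automaton. -/
def NBA.kSafra (A : NBA Q α) (r : LabelRule Q) (k : ℕ) (hk : 1 ≤ k) :
    NRA {t : SafraTree Q // t.IsState k} α (Label Q) where
  start := ⟨A.startTree, A.startTree_isState k hk⟩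
  Δ := fun t a => {t' | ∃ X ∈ SafraTree.rootChoices k (A.post (t.1.σ t.1.root) a),
    t'.1 = t.1.next A r a X}
  G := fun i => {t | i ∈ t.1.V ∧ t.1.χ i = Colour.Green}
  B := fun i => {t | i ∉ t.1.V}

end Construction

end KSafra

namespace KSafra

open Filter

/-! ### Lists -/

/-! Everything rests on one characterisation, `mem_acc_iff`: a run of the construction accepts iff
the sets at its roots contain an accepting run of the Büchi automaton. The root sets of a run of the
construction form a sequence of token sets as in the width game, so the claim becomes a comparison
of two ways of choosing such sets.

If label `l` persists and is green infinitely often, every state in `l` at one green time is reached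
through states of `l` from the previous green time with a visit to `F` in between
(`exists_extension`). These finite runs have arbitrarily many visits, and compactness of `ℕ → Q`
gives an infinite one (`exists_acceptingRun`). Conversely, suppose the roots contain an accepting
run, and take a node that eventually contains it and is minimal under eventual strict inclusion. If
this node were green only finitely often, the run would enter one of its children after a visit to
`F`, from then on could only move left among the children, and would settle in one
(`exists_persistent_child`), against minimality (`accepting_of_acceptingRun`).

For the languages, the root can be made to follow any given accepting run. A strategy with at most
`k` tokens yields a resolver by keeping its tokens inside the root set (`isGFG_of_winning`); a
resolver yields a strategy by playing its root sets (`player0Wins_of_isGFG`). -/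

theorem pair_sublist_or {β : Type*} {l : List β} {a b : β} (ha : a ∈ l) (hb : b ∈ l) (hab : a ≠ b) :
    List.Sublist [a, b] l ∨ List.Sublist [b, a] l := by
  induction l with
  | nil => simp at ha
  | cons x l ih =>
    rcases List.mem_cons.1 ha with rfl | ha'
    · left
      have hb' : b ∈ l := by simpa [hab.symm] using hb
      exact (List.singleton_sublist.2 hb').cons_cons _
    · rcases List.mem_cons.1 hb with rfl | hb'
      · exact Or.inr ((List.singleton_sublist.2 ha').cons_cons _)
      · exact (ih ha' hb').imp (fun h => h.cons _) (fun h => h.cons _)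

/-- The first element of a list with a given property. -/
theorem exists_first {β : Type*} {l : List β} (hl : l.Nodup) (p : β → Prop) {c : β} (hc : c ∈ l)
    (hp : p c) : ∃ c' ∈ l, p c' ∧ (c' = c ∨ List.Sublist [c', c] l) ∧
      ∀ d, List.Sublist [d, c'] l → ¬ p d := by
  induction l with
  | nil => simp at hc
  | cons x l ih =>
    have hx := List.nodup_cons.1 hl
    by_cases hpx : p x
    · refine ⟨x, by simp, hpx, ?_, ?_⟩
      · rcases List.mem_cons.1 hc with rfl | hc'
        · exact Or.inl rfl
        · exact Or.inr ((List.singleton_sublist.2 hc').cons_cons _)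
      · intro d hd
        exfalso
        rcases List.sublist_cons_iff.1 hd with h | ⟨r, hr, h⟩
        · exact hx.1 (h.subset (by simp))
        · simp only [List.cons.injEq] at hr
          exact hx.1 (h.subset (by simp [← hr.2]))
    · have hcx : c ∈ l := by
        rcases List.mem_cons.1 hc with rfl | hc'
        · exact absurd hp hpx
        · exact hc'
      obtain ⟨c', hc', hpc', h1, h2⟩ := ih hx.2 hcx
      refine ⟨c', List.mem_cons_of_mem _ hc', hpc', h1.imp_right (fun h => h.cons _), ?_⟩
      intro d hd
      rcases List.sublist_cons_iff.1 hd with h | ⟨r, hr, h⟩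
      · exact h2 d h
      · simp only [List.cons.injEq] at hr
        rw [hr.1]; exact hpx

/-- The position among siblings measures how far left a run has moved; deleting siblings must not
increase it. -/
theorem idxOf_filter_le {β : Type*} [DecidableEq β] (l : List β) (p : β → Bool) {c : β}
    (hp : p c = true) : (l.filter p).idxOf c ≤ l.idxOf c := by
  induction l with
  | nil => simp
  | cons x l ih =>
    by_cases hx : p x = true
    · rw [List.filter_cons_of_pos hx]
      by_cases hxc : x = c
      · subst hxc; simp
      · rw [List.idxOf_cons_ne _ hxc, List.idxOf_cons_ne _ hxc]; omega
    · rw [List.filter_cons_of_neg hx]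
      have hxc : x ≠ c := by rintro rfl; exact hx hp
      rw [List.idxOf_cons_ne _ hxc]; omega

theorem idxOf_lt_of_pair_sublist {β : Type*} [DecidableEq β] {l : List β} (hl : l.Nodup) {a b : β}
    (h : List.Sublist [a, b] l) : l.idxOf a < l.idxOf b := by
  induction l with
  | nil => simp at h
  | cons x l ih =>
    have hx := List.nodup_cons.1 hl
    rcases List.sublist_cons_iff.1 h with h' | ⟨r, hr, h'⟩
    · have ha : x ≠ a := by rintro rfl; exact hx.1 (h'.subset (by simp))
      have hb : x ≠ b := by rintro rfl; exact hx.1 (h'.subset (by simp))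
      rw [List.idxOf_cons_ne _ ha, List.idxOf_cons_ne _ hb]
      have := ih hx.2 h'
      omega
    · simp only [List.cons.injEq] at hr
      obtain ⟨rfl, rfl⟩ := hr
      have hb : a ≠ b := by rintro rfl; exact hx.1 (h'.subset (by simp))
      rw [List.idxOf_cons_ne _ hb]; simp

theorem NBA.post_mono {Q α : Type*} [DecidableEq Q] (A : NBA Q α) {Y Z : Finset Q} (h : Y ⊆ Z) (a : α) : A.post Y a ⊆ A.post Z a :=
  Finset.biUnion_subset_biUnion_of_subset_left _ h

theorem NBA.mem_post {Q α : Type*} [DecidableEq Q] {A : NBA Q α} {Y : Finset Q} {a : α} {s : Q} :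
    s ∈ A.post Y a ↔ ∃ p ∈ Y, s ∈ A.Δ p a := by simp [NBA.post]

/-! ### Ordered trees and the steps of a transition up to the horizontal merge -/

namespace SafraTree

variable {Q α : Type*} [Fintype Q]

/-! ### Ordered trees -/

/-- The set of a child is contained in the set of its parent. -/
def Nested (t : SafraTree Q) : Prop := ∀ u v, t.Child u v → t.σ v ⊆ t.σ u

theorem Nested.subset {t : SafraTree Q} (h : t.Nested) {u v : Label Q} (huv : t.InSubtree u v) :
    t.σ v ⊆ t.σ u := by
  induction huv with
  | refl => exact subset_rfl
  | tail _ hc ih => exact (h _ _ hc).trans ih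

theorem IsTree.inSubtree_parent {t : SafraTree Q} (ht : t.IsTree) {u v c : Label Q}
    (hc : t.Child v c) (h : t.InSubtree u c) (hne : u ≠ c) : t.InSubtree u v := by
  rcases Relation.ReflTransGen.cases_tail h with rfl | ⟨b, hb, hbc⟩
  · exact absurd rfl hne
  · rwa [ht.parent_unique _ _ _ hc hbc]

theorem IsTree.leftOf_or {t : SafraTree Q} (ht : t.IsTree) {v v' : Label Q} (hv : v ∈ t.V)
    (hv' : v' ∈ t.V) (h : ¬ t.InSubtree v v') (h' : ¬ t.InSubtree v' v) :
    t.LeftOf v v' ∨ t.LeftOf v' v := by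
  -- Descend from a common ancestor: as long as both nodes lie below the same child, go down; the
  -- first two distinct children decide the order.
  have key : ∀ u, t.InSubtree u v → t.InSubtree u v' → t.LeftOf v v' ∨ t.LeftOf v' v := by
    intro u hu
    induction hu using Relation.ReflTransGen.head_induction_on with
    | refl => exact fun h1 => absurd h1 h
    | @head u c huc hcv ih =>
      intro huv'
      rcases Relation.ReflTransGen.cases_head huv' with rfl | ⟨c', huc', hcv'⟩
      · exact absurd (Relation.ReflTransGen.head huc hcv) h'
      · by_cases hcc : c = c'
        · subst hcc; exact ih hcv'
        · rcases pair_sublist_or huc huc' hcc with hs | hs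
          · exact Or.inl ⟨u, c, c', hs, hcv, hcv'⟩
          · exact Or.inr ⟨u, c', c, hs, hcv', hcv⟩
  exact key _ (ht.reach v hv) (ht.reach v' hv')

theorem IsTree.not_leftOf_root {t : SafraTree Q} (ht : t.IsTree) (v : Label Q) :
    ¬ t.LeftOf v t.root := by
  rintro ⟨u, u₁, u₂, hs, -, h⟩
  rcases Relation.ReflTransGen.cases_tail h with h0 | ⟨b, _, hb⟩
  · exact ht.root_not_child u (h0 ▸ hs.subset (by simp))
  · exact ht.root_not_child b hb

theorem LeftOf.trans_inSubtree {t : SafraTree Q} {v u w : Label Q} (h : t.LeftOf v u)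
    (hw : t.InSubtree u w) : t.LeftOf v w := by
  obtain ⟨x, u₁, u₂, hs, h1, h2⟩ := h
  exact ⟨x, u₁, u₂, hs, h1, h2.trans hw⟩

theorem IsTree.congr {t t' : SafraTree Q} (ht : t.IsTree) (hV : t'.V = t.V)
    (hr : t'.root = t.root) (hcl : t'.cl = t.cl) : t'.IsTree := by
  obtain ⟨V, root, cl, σ, χ⟩ := t
  obtain ⟨V', root', cl', σ', χ'⟩ := t'
  simp only at hV hr hcl
  subst hV hr hcl
  exact ⟨ht.root_mem, ht.child_mem, ht.nodup, ht.root_not_child, ht.parent_unique, ht.reach⟩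

/-! ### Restriction to an ancestor-closed set of nodes -/

theorem child_restrict {t : SafraTree Q} {S : Finset (Label Q)} {u v : Label Q} :
    (t.restrict S).Child u v ↔ t.Child u v ∧ u ∈ S ∧ v ∈ S := by
  unfold Child restrict
  by_cases hu : u ∈ S <;> simp [hu]

theorem inSubtree_restrict {t : SafraTree Q} {S : Finset (Label Q)}
    (hS : ∀ u v, t.Child u v → v ∈ S → u ∈ S) {u v : Label Q} (hv : v ∈ S)
    (h : t.InSubtree u v) : (t.restrict S).InSubtree u v := by
  induction h with
  | refl => exact Relation.ReflTransGen.refl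
  | tail _ hc ih =>
    exact (ih (hS _ _ hc hv)).tail (child_restrict.2 ⟨hc, hS _ _ hc hv, hv⟩)

theorem mem_restrict {t : SafraTree Q} {S : Finset (Label Q)} {v : Label Q} :
    v ∈ (t.restrict S).V ↔ v ∈ t.V ∧ v ∈ S := by simp [restrict]

theorem restrict_σ {t : SafraTree Q} {S : Finset (Label Q)} {v : Label Q} (hv : v ∈ S) :
    (t.restrict S).σ v = t.σ v := by simp [restrict, hv]

theorem IsTree.restrict {t : SafraTree Q} (ht : t.IsTree) {S : Finset (Label Q)}
    (hS : ∀ u v, t.Child u v → v ∈ S → u ∈ S) (hr : t.root ∈ S) : (t.restrict S).IsTree where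
  root_mem := mem_restrict.2 ⟨ht.root_mem, hr⟩
  child_mem := by
    intro u v h
    obtain ⟨h, hu, hv⟩ := child_restrict.1 h
    have := ht.child_mem _ _ h
    exact ⟨mem_restrict.2 ⟨this.1, hu⟩, mem_restrict.2 ⟨this.2, hv⟩⟩
  nodup := by
    intro v
    by_cases hv : v ∈ S
    · simpa [SafraTree.restrict, hv] using (ht.nodup v).filter _
    · simp [SafraTree.restrict, hv]
  root_not_child := fun u h => ht.root_not_child u (child_restrict.1 h).1
  parent_unique := fun u u' v h h' =>
    ht.parent_unique u u' v (child_restrict.1 h).1 (child_restrict.1 h').1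
  reach := fun v hv =>
    inSubtree_restrict hS (mem_restrict.1 hv).2 (ht.reach v (mem_restrict.1 hv).1)

theorem Nested.restrict {t : SafraTree Q} (ht : t.Nested) (S : Finset (Label Q)) :
    (t.restrict S).Nested := by
  intro u v h
  obtain ⟨h, hu, hv⟩ := child_restrict.1 h
  rw [restrict_σ hu, restrict_σ hv]
  exact ht u v h

variable [DecidableEq Q]

theorem mem_childUnion {t : SafraTree Q} {v : Label Q} {s : Q} :
    s ∈ t.childUnion v ↔ ∃ c, t.Child v c ∧ s ∈ t.σ c := by
  simp [childUnion, Child]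

theorem IsState.nested {k : ℕ} {t : SafraTree Q} (ht : t.IsState k) : t.Nested := by
  intro u v h s hs
  have hne : t.cl u ≠ [] := List.ne_nil_of_mem h
  exact (ht.ssubset u (ht.tree.child_mem _ _ h).1 hne).1 (mem_childUnion.2 ⟨v, h, hs⟩)

theorem IsState.subset_root {k : ℕ} {t : SafraTree Q} (ht : t.IsState k) {v : Label Q}
    (hv : v ∈ t.V) : t.σ v ⊆ t.σ t.root := ht.nested.subset (ht.tree.reach v hv)

/-- Each node owns a state that is in none of its children. Such a state differs from those owned by
descendants by nesting, and from those owned by incomparable nodes by disjointness, so nodes inject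
into `Q`. The bound makes the properties of a `LabelRule` available. -/
theorem IsState.card_le_card {k : ℕ} {t : SafraTree Q} (ht : t.IsState k) :
    t.V.card ≤ Fintype.card Q := by
  by_cases hr : t.σ t.root = ∅
  · have hsub : t.V ⊆ {t.root} := fun v hv => Finset.mem_singleton.2
      (ht.nonempty v hv (Finset.subset_empty.1 (hr ▸ ht.subset_root hv)))
    have h1 := Finset.card_le_card hsub
    rw [Finset.card_singleton] at h1
    -- The root set may be empty, and then no state can be picked; but a label exists, so `2 *
    -- Fintype.card Q` is positive.
    have h2 := t.root.pos
    omega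
  · have hex : ∀ v, ∃ s, v ∈ t.V → s ∈ t.σ v ∧ s ∉ t.childUnion v := by
      intro v
      have hdef : ∃ s, s ∈ t.σ t.root := Finset.nonempty_iff_ne_empty.2 hr
      by_cases hv : v ∈ t.V
      · by_cases hcl : t.cl v = []
        · have : (t.σ v).Nonempty := by
            rw [Finset.nonempty_iff_ne_empty]
            intro h0
            exact hr (ht.nonempty v hv h0 ▸ h0)
          obtain ⟨s, hs⟩ := this
          exact ⟨s, fun _ => ⟨hs, by simp [childUnion, hcl]⟩⟩
        · obtain ⟨s, hs⟩ := Finset.exists_of_ssubset (ht.ssubset v hv hcl)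
          exact ⟨s, fun _ => hs⟩
      · exact ⟨hdef.choose, fun h => absurd h hv⟩
    choose g hg using hex
    have strict : ∀ v ∈ t.V, ∀ v' ∈ t.V, g v = g v' → t.InSubtree v v' → v = v' := by
      intro v hv v' hv' hgg h
      rcases Relation.ReflTransGen.cases_head h with rfl | ⟨c, hc, hcv⟩
      · rfl
      · exact absurd (mem_childUnion.2 ⟨c, hc, ht.nested.subset hcv (hg v' hv').1⟩)
          (hgg ▸ (hg v hv).2)
    have hinj : Set.InjOn g t.V := by
      intro v hv v' hv' hgg
      by_cases h1 : t.InSubtree v v'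
      · exact strict v hv v' hv' hgg h1
      by_cases h2 : t.InSubtree v' v
      · exact (strict v' hv' v hv hgg.symm h2).symm
      exact absurd (hgg ▸ (hg v' hv').1)
        (Finset.disjoint_left.1 (ht.disjoint v hv v' hv' h1 h2) (hg v hv).1)
    exact Finset.card_le_card_of_injOn g (fun _ _ => Finset.mem_univ _) hinj

/-! ### Expansion -/

section Expand

variable {A : NBA Q α} {fr : Label Q → Label Q} {t : SafraTree Q}

theorem child_expand {u v : Label Q} : (t.expand A fr).Child u v ↔
    t.Child u v ∨ (u ∈ t.V ∧ (t.σ u ∩ A.F).Nonempty ∧ v = fr u) := by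
  unfold Child expand
  dsimp only
  split_ifs with h
  · simp [h.1, h.2]
  · constructor
    · exact Or.inl
    · rintro (h' | h')
      · exact h'
      · exact absurd ⟨h'.1, h'.2.1⟩ h

theorem mem_expand {v : Label Q} : v ∈ (t.expand A fr).V ↔
    v ∈ t.V ∨ ∃ u ∈ t.V, (t.σ u ∩ A.F).Nonempty ∧ fr u = v := by
  simp [expand, and_assoc]

theorem expand_σ {v : Label Q} (hv : v ∈ t.V) : (t.expand A fr).σ v = t.σ v := by
  simp [expand, hv]

theorem expand_σ_fresh (hinj : Set.InjOn fr t.V) (hfr : ∀ v ∈ t.V, fr v ∉ t.V) {v : Label Q}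
    (hv : v ∈ t.V) : (t.expand A fr).σ (fr v) = t.σ v ∩ A.F := by
  have : t.V.filter (fun p => fr p = fr v) = {v} := by
    ext p
    simp only [Finset.mem_filter, Finset.mem_singleton]
    exact ⟨fun h => hinj h.1 hv h.2, by rintro rfl; exact ⟨hv, rfl⟩⟩
  simp [expand, hfr v hv, this]

theorem IsTree.expand (ht : t.IsTree) (hinj : Set.InjOn fr t.V) (hfr : ∀ v ∈ t.V, fr v ∉ t.V) :
    (t.expand A fr).IsTree where
  root_mem := mem_expand.2 (Or.inl ht.root_mem)
  child_mem := by
    intro u v h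
    rcases child_expand.1 h with h | ⟨hu, hF, rfl⟩
    · exact ⟨mem_expand.2 (Or.inl (ht.child_mem _ _ h).1),
        mem_expand.2 (Or.inl (ht.child_mem _ _ h).2)⟩
    · exact ⟨mem_expand.2 (Or.inl hu), mem_expand.2 (Or.inr ⟨u, hu, hF, rfl⟩)⟩
  nodup := by
    intro v
    unfold SafraTree.expand
    dsimp only
    split_ifs with h
    · rw [List.nodup_append]
      refine ⟨ht.nodup v, by simp, ?_⟩
      intro a ha b hb
      rw [List.mem_singleton.1 hb]
      rintro rfl
      exact hfr v h.1 (ht.child_mem _ _ ha).2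
    · exact ht.nodup v
  root_not_child := by
    intro u h
    rcases child_expand.1 h with h | ⟨hu, hF, h⟩
    · exact ht.root_not_child u h
    · exact hfr u hu (h ▸ ht.root_mem)
  parent_unique := by
    intro u u' v h h'
    rcases child_expand.1 h with h | ⟨hu, hF, rfl⟩
    · rcases child_expand.1 h' with h' | ⟨hu', hF', rfl⟩
      · exact ht.parent_unique _ _ _ h h'
      · exact absurd (ht.child_mem _ _ h).2 (hfr u' hu')
    · rcases child_expand.1 h' with h' | ⟨hu', hF', h'⟩
      · exact absurd (ht.child_mem _ _ h').2 (hfr u hu)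
      · exact hinj hu hu' h'
  reach := by
    have old : ∀ v ∈ t.V, (t.expand A fr).InSubtree t.root v := fun v hv =>
      Relation.ReflTransGen.mono (fun _ _ h => child_expand.2 (Or.inl h)) _ _ (ht.reach v hv)
    intro v hv
    rcases mem_expand.1 hv with hv | ⟨u, hu, hF, rfl⟩
    · exact old v hv
    · exact (old u hu).tail (child_expand.2 (Or.inr ⟨hu, hF, rfl⟩))

theorem Nested.expand (hn : t.Nested) (ht : t.IsTree) (hinj : Set.InjOn fr t.V)
    (hfr : ∀ v ∈ t.V, fr v ∉ t.V) : (t.expand A fr).Nested := by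
  intro u v h
  rcases child_expand.1 h with h | ⟨hu, hF, rfl⟩
  · rw [expand_σ (ht.child_mem _ _ h).1, expand_σ (ht.child_mem _ _ h).2]
    exact hn _ _ h
  · rw [expand_σ hu, expand_σ_fresh hinj hfr hu]
    exact Finset.inter_subset_left

end Expand

/-! ### Local subset construction and horizontal merge -/

theorem IsTree.advance {t : SafraTree Q} (ht : t.IsTree) (A : NBA Q α) (a : α) (X : Finset Q) :
    (t.advance A a X).IsTree := ht.congr rfl rfl rfl

theorem advance_σ_subset {t : SafraTree Q} (A : NBA Q α) (a : α) (X : Finset Q) (v : Label Q) :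
    (t.advance A a X).σ v ⊆ X := by
  unfold advance
  dsimp only
  split_ifs
  · exact subset_rfl
  · exact Finset.inter_subset_right

theorem advance_σ_root {t : SafraTree Q} (A : NBA Q α) (a : α) (X : Finset Q) :
    (t.advance A a X).σ t.root = X := by simp [advance]

theorem advance_σ {t : SafraTree Q} (A : NBA Q α) (a : α) (X : Finset Q) {v : Label Q}
    (hv : v ≠ t.root) : (t.advance A a X).σ v = A.post (t.σ v) a ∩ X := by simp [advance, hv]

theorem Nested.advance {t : SafraTree Q} (hn : t.Nested) (ht : t.IsTree) (A : NBA Q α) (a : α)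
    (X : Finset Q) : (t.advance A a X).Nested := by
  intro u v h
  have h' : t.Child u v := h
  have hv : v ≠ t.root := by rintro rfl; exact ht.root_not_child u h'
  by_cases hu : u = t.root
  · subst hu
    rw [advance_σ_root]
    exact advance_σ_subset A a X v
  · rw [advance_σ A a X hu, advance_σ A a X hv]
    exact Finset.inter_subset_inter_right (A.post_mono (hn u v h') a)

theorem mem_horizontal {t : SafraTree Q} {v : Label Q} {s : Q} : s ∈ t.horizontal.σ v ↔
    s ∈ t.σ v ∧ ∀ v' ∈ t.V, t.LeftOf v' v → s ∉ t.σ v' := by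
  simp [horizontal]

theorem IsTree.horizontal {t : SafraTree Q} (ht : t.IsTree) : t.horizontal.IsTree :=
  ht.congr rfl rfl rfl

/-- A node to the left of the parent is also to the left of the child, so whatever the parent loses
the child loses too. -/
theorem Nested.horizontal {t : SafraTree Q} (hn : t.Nested) : t.horizontal.Nested := by
  intro u v h s hs
  have h' : t.Child u v := h
  obtain ⟨h1, h2⟩ := mem_horizontal.1 hs
  exact mem_horizontal.2 ⟨hn u v h' h1, fun v' hv' hl =>
    h2 v' hv' (hl.trans_inSubtree (Relation.ReflTransGen.single h'))⟩

theorem IsTree.disjoint_horizontal {t : SafraTree Q} (ht : t.IsTree) {v v' : Label Q}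
    (hv : v ∈ t.V) (hv' : v' ∈ t.V) (h : ¬ t.InSubtree v v') (h' : ¬ t.InSubtree v' v) :
    Disjoint (t.horizontal.σ v) (t.horizontal.σ v') := by
  rw [Finset.disjoint_left]
  intro s hs hs'
  obtain ⟨h1, h2⟩ := mem_horizontal.1 hs
  obtain ⟨h1', h2'⟩ := mem_horizontal.1 hs'
  rcases ht.leftOf_or hv hv' h h' with hl | hl
  · exact h2' v hv hl h1
  · exact h2 v' hv' hl h1'

/-- A state that survives in `v` and is in a child of `v` before the horizontal merge is in a child
of `v` afterwards, possibly further to the left. -/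
theorem IsTree.exists_child_horizontal {t : SafraTree Q} (ht : t.IsTree) (hn : t.Nested)
    {v c : Label Q} {s : Q} (hc : t.Child v c) (hs : s ∈ t.σ c) (hv : s ∈ t.horizontal.σ v) :
    ∃ c', t.Child v c' ∧ s ∈ t.horizontal.σ c' ∧ (c' = c ∨ List.Sublist [c', c] (t.cl v)) := by
  -- `c'` is the leftmost child of `v` that contains `s`. A node that removes `s` from `c'` would
  -- lie below a child further left, or would be to the left of `v` itself.
  obtain ⟨c', hc', hsc', hle, hfirst⟩ := exists_first (ht.nodup v) (fun d => s ∈ t.σ d) hc hs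
  refine ⟨c', hc', mem_horizontal.2 ⟨hsc', ?_⟩, hle⟩
  rintro w hw ⟨u, u₁, u₂, hsub, h1, h2⟩ hsw
  by_cases hu : u₂ = c'
  · subst hu
    have huv : u = v := ht.parent_unique _ _ _ (hsub.subset (by simp)) hc'
    subst huv
    exact hfirst u₁ hsub (hn.subset h1 hsw)
  · exact (mem_horizontal.1 hv).2 w hw ⟨u, u₁, u₂, hsub, h1, ht.inSubtree_parent hc' h2 hu⟩ hsw

end SafraTree
end KSafra

/-! ### Cleaning, vertical merge and the successor state -/

namespace KSafra

open Filter

namespace SafraTree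

variable {Q α : Type*} [Fintype Q]

/-! ### Removal of empty nodes -/

theorem mem_removeEmpty {t : SafraTree Q} {v : Label Q} :
    v ∈ t.removeEmpty.V ↔ v ∈ t.V ∧ (v = t.root ∨ (t.σ v).Nonempty) := by
  simp [removeEmpty, mem_restrict]

theorem child_removeEmpty {t : SafraTree Q} (ht : t.IsTree) (hn : t.Nested) {u v : Label Q} :
    t.removeEmpty.Child u v ↔ t.Child u v ∧ (t.σ v).Nonempty := by
  rw [removeEmpty, child_restrict]
  simp only [Finset.mem_filter]
  constructor
  · rintro ⟨h, _, _, rfl | hv⟩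
    · exact absurd h (ht.root_not_child u)
    · exact ⟨h, hv⟩
  · rintro ⟨h, hv⟩
    exact ⟨h, ⟨(ht.child_mem _ _ h).1, Or.inr (hv.mono (hn _ _ h))⟩,
      (ht.child_mem _ _ h).2, Or.inr hv⟩

theorem removeEmpty_σ {t : SafraTree Q} {v : Label Q} (hv : v ∈ t.removeEmpty.V) :
    t.removeEmpty.σ v = t.σ v :=
  restrict_σ (mem_restrict.1 hv).2

theorem IsTree.removeEmpty {t : SafraTree Q} (ht : t.IsTree) (hn : t.Nested) :
    t.removeEmpty.IsTree := by
  refine ht.restrict (fun u v h hv => ?_) (by simp [ht.root_mem])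
  simp only [Finset.mem_filter] at hv ⊢
  rcases hv.2 with rfl | hv
  · exact absurd h (ht.root_not_child u)
  · exact ⟨(ht.child_mem _ _ h).1, Or.inr (hv.mono (hn _ _ h))⟩

variable [DecidableEq Q]

/-! ### Vertical merge -/

open Classical in
/-- The nodes that survive the vertical merge. -/
noncomputable def survivors (t : SafraTree Q) : Finset (Label Q) :=
  t.V.filter (fun v => ¬ ∃ u, t.Full u ∧ Relation.TransGen t.Child u v)

theorem mem_survivors {t : SafraTree Q} {v : Label Q} :
    v ∈ t.survivors ↔ v ∈ t.V ∧ ∀ u, t.Full u → ¬ Relation.TransGen t.Child u v := by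
  simp [survivors]

theorem mem_vertical {t : SafraTree Q} {v : Label Q} : v ∈ t.vertical.V ↔ v ∈ t.survivors := by
  have : v ∈ t.vertical.V ↔ v ∈ t.V ∧ v ∈ t.survivors := mem_restrict
  rw [this]
  exact ⟨fun h => h.2, fun h => ⟨(mem_survivors.1 h).1, h⟩⟩

theorem vertical_σ {t : SafraTree Q} {v : Label Q} (hv : v ∈ t.vertical.V) :
    t.vertical.σ v = t.σ v :=
  restrict_σ (mem_vertical.1 hv)

open Classical in
theorem vertical_green {t : SafraTree Q} {v : Label Q} (hv : v ∈ t.vertical.V) :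
    t.vertical.χ v = Colour.Green ↔ t.Full v := by
  have hv' : v ∈ t.survivors := mem_vertical.1 hv
  have : t.vertical.χ v = if v ∈ t.survivors then
      (if t.Full v then Colour.Green else Colour.White) else Colour.White := rfl
  rw [this, if_pos hv']
  split_ifs with h <;> simp [h]

/-- A full strict ancestor of `v` is either `u` or a strict ancestor of `u`, and the second case is
excluded when `u` survives. -/
theorem child_vertical {t : SafraTree Q} (ht : t.IsTree) {u v : Label Q} :
    t.vertical.Child u v ↔ t.Child u v ∧ u ∈ t.vertical.V ∧ ¬ t.Full u := by
  have : t.vertical.Child u v ↔ t.Child u v ∧ u ∈ t.survivors ∧ v ∈ t.survivors := child_restrict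
  rw [this, mem_vertical]
  refine and_congr_right fun h => and_congr_right fun hu => ?_
  rw [mem_survivors] at hu ⊢
  constructor
  · intro hv hf
    exact hv.2 u hf (Relation.TransGen.single h)
  · intro hf
    refine ⟨(ht.child_mem _ _ h).2, fun w hw hwv => ?_⟩
    rcases Relation.TransGen.tail'_iff.1 hwv with ⟨b, hwb, hbv⟩
    obtain rfl := ht.parent_unique _ _ _ h hbv
    rcases Relation.reflTransGen_iff_eq_or_transGen.1 hwb with rfl | hwb
    · exact hf hw
    · exact hu.2 w hw hwb

theorem survivors_closed {t : SafraTree Q} (ht : t.IsTree) {u v : Label Q} (h : t.Child u v)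
    (hv : v ∈ t.survivors) : u ∈ t.survivors := by
  rw [mem_survivors] at hv ⊢
  exact ⟨(ht.child_mem _ _ h).1, fun w hw hwu => hv.2 w hw (hwu.tail h)⟩

open Classical in
theorem IsTree.vertical {t : SafraTree Q} (ht : t.IsTree) : t.vertical.IsTree := by
  refine IsTree.restrict (S := t.survivors)
    (t := { t with χ := fun v => if t.Full v then Colour.Green else Colour.White })
    (ht.congr rfl rfl rfl) (fun u v h hv => survivors_closed ht h hv) ?_
  refine mem_survivors.2 ⟨ht.root_mem, fun u _ h => ?_⟩
  rcases Relation.TransGen.tail'_iff.1 h with ⟨b, _, hb⟩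
  exact ht.root_not_child b hb

/-- A survivor that still has a child is not full and has kept all its children, so its child union
is unchanged and proper. The other conditions are inherited. -/
theorem isState_vertical {k : ℕ} {t : SafraTree Q} (ht : t.IsTree) (hn : t.Nested)
    (hdis : ∀ v ∈ t.V, ∀ v' ∈ t.V, ¬ t.InSubtree v v' → ¬ t.InSubtree v' v →
      Disjoint (t.σ v) (t.σ v'))
    (hne : ∀ v ∈ t.V, t.σ v = ∅ → v = t.root) (hcard : ∀ v ∈ t.V, (t.σ v).card ≤ k) :
    t.vertical.IsState k where
  tree := ht.vertical
  off := by
    intro v hv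
    have hv' : v ∉ t.survivors := fun h => hv (mem_vertical.2 h)
    exact ⟨if_neg hv', if_neg hv'⟩
  ssubset := by
    intro v hv hcl
    obtain ⟨c, hc⟩ := List.exists_mem_of_ne_nil _ hcl
    have hc' := (child_vertical ht).1 (show t.vertical.Child v c from hc)
    have heq : t.vertical.childUnion v = t.childUnion v := by
      ext s
      simp only [mem_childUnion, child_vertical ht]
      constructor
      · rintro ⟨d, ⟨hd, h1, h2⟩, hs⟩
        rw [vertical_σ (ht.vertical.child_mem v d ((child_vertical ht).2 ⟨hd, h1, h2⟩)).2] at hs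
        exact ⟨d, hd, hs⟩
      · rintro ⟨d, hd, hs⟩
        have := (child_vertical ht).2 ⟨hd, hc'.2⟩
        refine ⟨d, ⟨hd, hc'.2⟩, ?_⟩
        rwa [vertical_σ (ht.vertical.child_mem v d this).2]
    rw [heq, vertical_σ hv]
    refine Finset.ssubset_iff_subset_ne.2 ⟨fun s hs => ?_, fun h => hc'.2.2
      ⟨(mem_survivors.1 (mem_vertical.1 hv)).1, List.ne_nil_of_mem hc'.1, h⟩⟩
    obtain ⟨d, hd, hs⟩ := mem_childUnion.1 hs
    exact hn _ _ hd hs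
  disjoint := by
    intro v hv v' hv' h h'
    rw [vertical_σ hv, vertical_σ hv']
    have hv1 := mem_vertical.1 hv
    have hv1' := mem_vertical.1 hv'
    exact hdis v (mem_survivors.1 hv1).1 v' (mem_survivors.1 hv1').1
      (fun hs => h (inSubtree_restrict (fun u w h hw => survivors_closed ht h hw) hv1' hs))
      (fun hs => h' (inSubtree_restrict (fun u w h hw => survivors_closed ht h hw) hv1 hs))
  nonempty := by
    intro v hv h
    rw [vertical_σ hv] at h
    exact hne v (mem_survivors.1 (mem_vertical.1 hv)).1 h
  card_le := by
    intro v hv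
    rw [vertical_σ hv]
    exact hcard v (mem_survivors.1 (mem_vertical.1 hv)).1

/-! ### The successor of a state -/

/-- The tree before the horizontal merge. -/
def advanced (A : NBA Q α) (r : LabelRule Q) (t : SafraTree Q) (a : α) (X : Finset Q) :
    SafraTree Q :=
  (t.expand A (r.fresh t)).advance A a X

/-- The tree before the vertical merge. -/
noncomputable def merged (A : NBA Q α) (r : LabelRule Q) (t : SafraTree Q) (a : α)
    (X : Finset Q) : SafraTree Q :=
  (t.advanced A r a X).horizontal.removeEmpty

theorem next_eq (A : NBA Q α) (r : LabelRule Q) (t : SafraTree Q) (a : α) (X : Finset Q) :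
    t.next A r a X = (t.merged A r a X).vertical := rfl

theorem next_σ {A : NBA Q α} {r : LabelRule Q} {t : SafraTree Q} {a : α} {X : Finset Q}
    {v : Label Q} (hv : v ∈ (t.next A r a X).V) :
    (t.next A r a X).σ v = (t.merged A r a X).σ v := vertical_σ (t := t.merged A r a X) hv

theorem mem_merged_of_mem_next {A : NBA Q α} {r : LabelRule Q} {t : SafraTree Q} {a : α}
    {X : Finset Q} {v : Label Q} (hv : v ∈ (t.next A r a X).V) : v ∈ (t.merged A r a X).V :=
  (mem_survivors.1 (mem_vertical.1 hv)).1

theorem merged_σ {A : NBA Q α} {r : LabelRule Q} {t : SafraTree Q} {a : α} {X : Finset Q}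
    {v : Label Q} (hv : v ∈ (t.merged A r a X).V) :
    (t.merged A r a X).σ v = (t.advanced A r a X).horizontal.σ v := removeEmpty_σ hv

theorem merged_σ_subset {A : NBA Q α} {r : LabelRule Q} {t : SafraTree Q} {a : α} {X : Finset Q}
    {v : Label Q} (hv : v ∈ (t.merged A r a X).V) :
    (t.merged A r a X).σ v ⊆ (t.advanced A r a X).σ v := by
  rw [merged_σ hv]
  exact fun s hs => (mem_horizontal.1 hs).1

namespace IsState

variable {k : ℕ} {t : SafraTree Q} (ht : t.IsState k) (A : NBA Q α) (r : LabelRule Q) (a : α)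
  (X : Finset Q)
include ht

theorem isTree_advanced : (t.advanced A r a X).IsTree :=
  (ht.tree.expand (r.injOn t ht.card_le_card) (r.not_mem t ht.card_le_card)).advance A a X

theorem nested_advanced : (t.advanced A r a X).Nested :=
  (ht.nested.expand ht.tree (r.injOn t ht.card_le_card) (r.not_mem t ht.card_le_card)).advance
    (ht.tree.expand (r.injOn t ht.card_le_card) (r.not_mem t ht.card_le_card)) A a X

theorem isTree_merged : (t.merged A r a X).IsTree :=
  (ht.isTree_advanced A r a X).horizontal.removeEmpty (ht.nested_advanced A r a X).horizontal

theorem nested_merged : (t.merged A r a X).Nested :=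
  (ht.nested_advanced A r a X).horizontal.restrict _

theorem child_merged {u v : Label Q} : (t.merged A r a X).Child u v ↔
    (t.advanced A r a X).Child u v ∧ ((t.advanced A r a X).horizontal.σ v).Nonempty :=
  child_removeEmpty (ht.isTree_advanced A r a X).horizontal
    (ht.nested_advanced A r a X).horizontal

/-- The horizontal merge gives disjointness, cleaning gives nonempty sets, the vertical merge gives
proper inclusions, and containment in `X` gives the size bound. -/
theorem next (hX : X.card ≤ k) : (t.next A r a X).IsState k := by
  rw [next_eq]
  have htr := ht.isTree_advanced A r a X
  refine isState_vertical (ht.isTree_merged A r a X) (ht.nested_merged A r a X) ?_ ?_ ?_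
  · intro v hv v' hv' h h'
    rw [merged_σ hv, merged_σ hv']
    have h1 := mem_removeEmpty.1 hv
    have h1' := mem_removeEmpty.1 hv'
    have hS : ∀ u v, (t.advanced A r a X).horizontal.Child u v →
        v ∈ (t.merged A r a X).V → u ∈ (t.merged A r a X).V := by
      intro u v h hv
      rcases (mem_removeEmpty.1 hv).2 with rfl | h0
      · exact absurd h (htr.root_not_child u)
      · exact ((ht.isTree_merged A r a X).child_mem u v
          ((ht.child_merged A r a X).2 ⟨h, h0⟩)).1
    have hsub : ∀ {u v}, v ∈ (t.merged A r a X).V →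
        (t.advanced A r a X).horizontal.InSubtree u v → (t.merged A r a X).InSubtree u v := by
      intro u v hv h
      refine inSubtree_restrict (fun u v h hv => (mem_restrict.1 (hS u v h ?_)).2)
        (mem_restrict.1 hv).2 h
      exact mem_restrict.2 ⟨(htr.child_mem _ _ h).2, hv⟩
    exact htr.disjoint_horizontal h1.1 h1'.1 (fun h2 => h (hsub hv' h2))
      (fun h2 => h' (hsub hv h2))
  · intro v hv h
    rw [merged_σ hv] at h
    rcases (mem_removeEmpty.1 hv).2 with h0 | h0
    · exact h0
    · rw [h] at h0
      simp at h0
  · intro v hv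
    exact (Finset.card_le_card ((merged_σ_subset hv).trans
      (advance_σ_subset A a X v))).trans hX

theorem next_σ_root : (t.next A r a X).σ t.root = X := by
  have hr : t.root ∈ (t.next A r a X).V := (ht.isTree_merged A r a X).vertical.root_mem
  rw [next_σ hr, merged_σ (mem_merged_of_mem_next hr)]
  ext s
  rw [mem_horizontal]
  have h1 : (t.advanced A r a X).σ t.root = X := advance_σ_root (t := t.expand A _) A a X
  rw [h1]
  exact ⟨fun h => h.1, fun h => ⟨h, fun v' _ hl =>
    absurd hl ((ht.isTree_advanced A r a X).not_leftOf_root v')⟩⟩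

theorem next_σ_subset_post (hX : X ⊆ A.post (t.σ t.root) a) {v : Label Q} (hv : v ∈ t.V)
    (hv' : v ∈ (t.next A r a X).V) : (t.next A r a X).σ v ⊆ A.post (t.σ v) a := by
  by_cases h : v = t.root
  · subst h
    rwa [ht.next_σ_root]
  · rw [next_σ hv']
    refine (merged_σ_subset (mem_merged_of_mem_next hv')).trans ?_
    have h1 : (t.advanced A r a X).σ v = A.post ((t.expand A (r.fresh t)).σ v) a ∩ X :=
      advance_σ (t := t.expand A (r.fresh t)) A a X h
    rw [h1, expand_σ hv]
    exact Finset.inter_subset_left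

/-- A state in a child of `v` comes from a state in a child of `v` or from an accepting state
in `v`. -/
theorem exists_of_mem_childUnion_merged {v : Label Q} {s : Q}
    (hs : s ∈ (t.merged A r a X).childUnion v) (hv : v ∈ t.V) :
    ∃ p, s ∈ A.Δ p a ∧ (p ∈ t.childUnion v ∨ p ∈ t.σ v ∧ p ∈ A.F) := by
  obtain ⟨c, hc, hs⟩ := mem_childUnion.1 hs
  have hsc := merged_σ_subset ((ht.isTree_merged A r a X).child_mem _ _ hc).2 hs
  have hc' := ((ht.child_merged A r a X).1 hc).1
  have hcr : c ≠ t.root := fun h => (ht.isTree_advanced A r a X).root_not_child v (h ▸ hc')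
  have h1 : (t.advanced A r a X).σ c = A.post ((t.expand A (r.fresh t)).σ c) a ∩ X :=
    advance_σ (t := t.expand A (r.fresh t)) A a X hcr
  rw [h1] at hsc
  obtain ⟨p, hp, hps⟩ := NBA.mem_post.1 (Finset.mem_inter.1 hsc).1
  refine ⟨p, hps, ?_⟩
  rcases child_expand.1 (show (t.expand A (r.fresh t)).Child v c from hc') with h | ⟨_, _, rfl⟩
  · rw [expand_σ (ht.tree.child_mem _ _ h).2] at hp
    exact Or.inl (mem_childUnion.2 ⟨c, h, hp⟩)
  · rw [expand_σ_fresh (r.injOn t ht.card_le_card) (r.not_mem t ht.card_le_card) hv] at hp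
    exact Or.inr (Finset.mem_inter.1 hp)

theorem childUnion_next_subset {v : Label Q} :
    (t.next A r a X).childUnion v ⊆ (t.merged A r a X).childUnion v := by
  intro s hs
  obtain ⟨c, hc, hs⟩ := mem_childUnion.1 hs
  have htm := ht.isTree_merged A r a X
  rw [next_σ (htm.vertical.child_mem _ _ hc).2] at hs
  exact mem_childUnion.2 ⟨c, ((child_vertical htm).1 hc).1, hs⟩

/-- A green node keeps the union of the children it has just lost. Hence its states can be traced
back through a child or an accepting state, and it starts again as a leaf. -/
theorem next_σ_of_green {v : Label Q} (hv : v ∈ (t.next A r a X).V)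
    (hg : (t.next A r a X).χ v = Colour.Green) :
    (t.next A r a X).σ v = (t.merged A r a X).childUnion v ∧ ((t.next A r a X).σ v).Nonempty ∧
      (t.next A r a X).childUnion v = ∅ := by
  have hf : (t.merged A r a X).Full v := (vertical_green hv).1 hg
  have htm := ht.isTree_merged A r a X
  refine ⟨?_, ?_, ?_⟩
  · rw [next_σ hv, hf.2.2]
  · rw [next_σ hv]
    obtain ⟨c, hc⟩ := List.exists_mem_of_ne_nil _ hf.2.1
    have hc' := ((ht.child_merged A r a X).1 hc).2
    rw [← merged_σ (htm.child_mem v c hc).2] at hc'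
    exact hc'.mono (ht.nested_merged A r a X v c hc)
  · refine Finset.eq_empty_of_forall_notMem fun s hs => ?_
    obtain ⟨c, hc, _⟩ := mem_childUnion.1 hs
    exact ((child_vertical htm).1 hc).2.2 hf

/-- A state that is in a child of `v` before the horizontal merge ends up in a child of `v`,
unless `v` becomes green. -/
theorem exists_child_next {v c : Label Q} {s : Q} (hv : v ∈ (t.next A r a X).V)
    (hg : (t.next A r a X).χ v ≠ Colour.Green) (hsv : s ∈ (t.next A r a X).σ v)
    (hc : (t.advanced A r a X).Child v c) (hs : s ∈ (t.advanced A r a X).σ c) :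
    ∃ c', (t.next A r a X).Child v c' ∧ s ∈ (t.next A r a X).σ c' ∧
      (c' = c ∨ List.Sublist [c', c] ((t.advanced A r a X).cl v)) := by
  have htm := ht.isTree_merged A r a X
  have hvm := mem_merged_of_mem_next hv
  rw [next_σ hv, merged_σ hvm] at hsv
  obtain ⟨c', hc', hsc', hle⟩ := (ht.isTree_advanced A r a X).exists_child_horizontal
    (ht.nested_advanced A r a X) hc hs hsv
  have h1 : (t.merged A r a X).Child v c' := (ht.child_merged A r a X).2 ⟨hc', ⟨s, hsc'⟩⟩
  have h2 : (t.next A r a X).Child v c' :=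
    (child_vertical htm).2 ⟨h1, hv, fun h => hg ((vertical_green hv).2 h)⟩
  refine ⟨c', h2, ?_, hle⟩
  rwa [next_σ (htm.vertical.child_mem _ _ h2).2,
    merged_σ (htm.child_mem _ _ h1).2]

/-- The missing condition `s ∈ X` comes from `s` being in the new set of `v`, since all sets are cut
down to `X`. -/
theorem mem_advanced_σ {v c : Label Q} {s : Q} (hv : v ∈ (t.next A r a X).V)
    (hsv : s ∈ (t.next A r a X).σ v) (hc : (t.advanced A r a X).Child v c)
    (hs : s ∈ A.post ((t.expand A (r.fresh t)).σ c) a) : s ∈ (t.advanced A r a X).σ c := by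
  have hcr : c ≠ t.root := fun h => (ht.isTree_advanced A r a X).root_not_child v (h ▸ hc)
  have h1 : (t.advanced A r a X).σ c = A.post ((t.expand A (r.fresh t)).σ c) a ∩ X :=
    advance_σ (t := t.expand A (r.fresh t)) A a X hcr
  rw [next_σ hv] at hsv
  rw [h1]
  exact Finset.mem_inter.2 ⟨hs, advance_σ_subset A a X v
    (merged_σ_subset (mem_merged_of_mem_next hv) hsv)⟩

/-- Successors of accepting states in `v` are in children of `v`, unless `v` becomes green. -/
theorem exists_child_next_of_mem_F {v : Label Q} {p s : Q} (hvt : v ∈ t.V)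
    (hv : v ∈ (t.next A r a X).V) (hg : (t.next A r a X).χ v ≠ Colour.Green)
    (hp : p ∈ t.σ v) (hF : p ∈ A.F) (hps : s ∈ A.Δ p a) (hsv : s ∈ (t.next A r a X).σ v) :
    ∃ c, (t.next A r a X).Child v c ∧ s ∈ (t.next A r a X).σ c := by
  have hpF : p ∈ t.σ v ∩ A.F := Finset.mem_inter.2 ⟨hp, hF⟩
  have hc : (t.advanced A r a X).Child v (r.fresh t v) :=
    child_expand.2 (Or.inr ⟨hvt, ⟨p, hpF⟩, rfl⟩)
  obtain ⟨c, h1, h2, _⟩ := ht.exists_child_next A r a X hv hg hsv hc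
    (ht.mem_advanced_σ A r a X hv hsv hc (by
      rw [expand_σ_fresh (r.injOn t ht.card_le_card) (r.not_mem t ht.card_le_card) hvt]
      exact NBA.mem_post.2 ⟨p, hpF, hps⟩))
  exact ⟨c, h1, h2⟩

/-- The child of `v` that contains the current state of a run can only move to the left, unless
`v` becomes green. -/
theorem exists_child_next_of_child {v c : Label Q} {p s : Q}
    (hv : v ∈ (t.next A r a X).V) (hg : (t.next A r a X).χ v ≠ Colour.Green)
    (hc : t.Child v c) (hp : p ∈ t.σ c) (hps : s ∈ A.Δ p a) (hsv : s ∈ (t.next A r a X).σ v) :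
    ∃ c', (t.next A r a X).Child v c' ∧ s ∈ (t.next A r a X).σ c' ∧
      ((t.next A r a X).cl v).idxOf c' ≤ (t.cl v).idxOf c ∧
      (c' ≠ c → ((t.next A r a X).cl v).idxOf c' < (t.cl v).idxOf c) := by
  have hc' : (t.advanced A r a X).Child v c := child_expand.2 (Or.inl hc)
  have hcV := ht.tree.child_mem _ _ hc
  obtain ⟨d, h1, h2, h3⟩ := ht.exists_child_next A r a X hv hg hsv hc'
    (ht.mem_advanced_σ A r a X hv hsv hc' (by
      rw [expand_σ hcV.2]
      exact NBA.mem_post.2 ⟨p, hp, hps⟩))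
  -- The new child is appended on the right and so leaves the positions of the old ones unchanged.
  have hidx : ((t.advanced A r a X).cl v).idxOf c = (t.cl v).idxOf c := by
    show (ite _ _ _ : List (Label Q)).idxOf c = _
    split_ifs
    · exact List.idxOf_append_of_mem hc
    · rfl
  -- Cleaning and vertical merge only filter the list of children.
  have hle : ((t.next A r a X).cl v).idxOf d ≤ ((t.advanced A r a X).cl v).idxOf d := by
    have hm : d ∈ (t.merged A r a X).cl v := ((child_vertical (ht.isTree_merged A r a X)).1 h1).1
    have e1 : ((t.next A r a X).cl v).idxOf d ≤ ((t.merged A r a X).cl v).idxOf d := by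
      rw [next_eq] at h1 ⊢
      unfold SafraTree.vertical SafraTree.restrict Child at *
      dsimp only at *
      split_ifs at h1 ⊢ with hS
      · exact idxOf_filter_le _ _ (List.mem_filter.1 h1).2
      · simp at h1
    refine e1.trans ?_
    unfold merged SafraTree.removeEmpty SafraTree.restrict at *
    dsimp only at *
    split_ifs at hm ⊢ with hS
    · exact idxOf_filter_le _ _ (List.mem_filter.1 hm).2
    · simp at hm
  refine ⟨d, h1, h2, ?_, ?_⟩
  · rcases h3 with rfl | h3
    · omega
    · have := idxOf_lt_of_pair_sublist ((ht.isTree_advanced A r a X).nodup v) h3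
      omega
  · intro hdc
    have := idxOf_lt_of_pair_sublist ((ht.isTree_advanced A r a X).nodup v) (h3.resolve_left hdc)
    omega

end IsState

end SafraTree
end KSafra

/-! ### Acceptance for runs of trees -/

namespace KSafra

open Filter

variable {Q α : Type*} [Fintype Q] [DecidableEq Q]

omit [Fintype Q] [DecidableEq Q] in
theorem SafraTree.rootChoices_spec {k : ℕ} {D X : Finset Q} (h : X ∈ SafraTree.rootChoices k D) :
    X ⊆ D ∧ X.card ≤ k := by
  unfold SafraTree.rootChoices at h
  simp only [Set.mem_ofPred_eq] at h
  split_ifs at h with hD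
  · subst h; exact ⟨subset_rfl, hD⟩
  · exact ⟨h.1, h.2.le⟩

/-! ### Runs of the `k`-Safra construction -/

/-- The sequence of trees of a run of the `k`-Safra construction on the word `w`. -/
structure TreeRun (A : NBA Q α) (r : LabelRule Q) (k : ℕ) (w : ℕ → α) (t : ℕ → SafraTree Q) :
    Prop where
  isState : ∀ i, (t i).IsState k
  start : t 0 = A.startTree
  step : ∀ i, ∃ X ∈ SafraTree.rootChoices k (A.post ((t i).σ (t i).root) (w i)),
    t (i + 1) = (t i).next A r (w i) X

theorem treeRun_of_isRun {A : NBA Q α} {r : LabelRule Q} {k : ℕ} {hk : 1 ≤ k} {w : ℕ → α}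
    {τ : ℕ → {t : SafraTree Q // t.IsState k}} (h : (A.kSafra r k hk).toOmega.IsRun w τ) :
    TreeRun A r k w (fun i => (τ i).1) where
  isState := fun i => (τ i).2
  start := congrArg Subtype.val h.1
  step := h.2

namespace TreeRun

variable {A : NBA Q α} {r : LabelRule Q} {k : ℕ} {w : ℕ → α} {t : ℕ → SafraTree Q}

theorem root_succ (h : TreeRun A r k w t) (i : ℕ) : (t (i + 1)).root = (t i).root := by
  obtain ⟨X, _, hX⟩ := h.step i
  rw [hX]; rfl

theorem root_eq (h : TreeRun A r k w t) (i : ℕ) : (t i).root = A.firstLabel := by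
  induction i with
  | zero => rw [h.start]; rfl
  | succ i ih => rw [h.root_succ, ih]

theorem σ_root_zero (h : TreeRun A r k w t) : (t 0).σ (t 0).root = {A.start} := by
  rw [h.start]; simp [NBA.startTree]

theorem exists_pred (h : TreeRun A r k w t) {i : ℕ} {v : Label Q} {s : Q} (hv : v ∈ (t i).V)
    (hv' : v ∈ (t (i + 1)).V) (hs : s ∈ (t (i + 1)).σ v) : ∃ p ∈ (t i).σ v, s ∈ A.Δ p (w i) := by
  obtain ⟨X, hX, hn⟩ := h.step i
  rw [hn] at hv' hs
  exact NBA.mem_post.1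
    ((h.isState i).next_σ_subset_post A r (w i) X (SafraTree.rootChoices_spec hX).1 hv hv' hs)

theorem exists_pred_root (h : TreeRun A r k w t) {i : ℕ} {s : Q}
    (hs : s ∈ (t (i + 1)).σ (t (i + 1)).root) :
    ∃ p ∈ (t i).σ (t i).root, s ∈ A.Δ p (w i) := by
  rw [h.root_succ] at hs
  exact h.exists_pred (h.isState i).tree.root_mem
    (h.root_succ i ▸ (h.isState (i + 1)).tree.root_mem) hs

/-- The two alternatives are treated alike because a green node's set is its child union before the
vertical merge. -/
theorem exists_pred_of_mem_childUnion (h : TreeRun A r k w t) {i : ℕ} {v : Label Q} {s : Q}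
    (hv : v ∈ (t i).V) (hv' : v ∈ (t (i + 1)).V)
    (hs : s ∈ (t (i + 1)).childUnion v ∨
      ((t (i + 1)).χ v = Colour.Green ∧ s ∈ (t (i + 1)).σ v)) :
    ∃ p, s ∈ A.Δ p (w i) ∧ (p ∈ (t i).childUnion v ∨ p ∈ (t i).σ v ∧ p ∈ A.F) := by
  obtain ⟨X, hX, hn⟩ := h.step i
  rw [hn] at hv' hs
  refine (h.isState i).exists_of_mem_childUnion_merged A r (w i) X ?_ hv
  rcases hs with hs | ⟨hg, hs⟩
  · exact (h.isState i).childUnion_next_subset A r (w i) X hs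
  · rwa [← ((h.isState i).next_σ_of_green A r (w i) X hv' hg).1]

theorem green_spec (h : TreeRun A r k w t) {i : ℕ} {v : Label Q} (hv : v ∈ (t i).V)
    (hg : (t i).χ v = Colour.Green) :
    ((t i).σ v).Nonempty ∧ (t i).childUnion v = ∅ := by
  cases i with
  | zero =>
    rw [h.start] at hg
    exact absurd hg (by simp [NBA.startTree])
  | succ i =>
    obtain ⟨X, hX, hn⟩ := h.step i
    rw [hn] at hv hg ⊢
    exact ((h.isState i).next_σ_of_green A r (w i) X hv hg).2

/-! ### Accepting runs of the construction contain accepting runs of the automaton -/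

/-- `ρ` is a run up to time `m` that stays in the sets of the roots. -/
def RunUpTo (A : NBA Q α) (w : ℕ → α) (t : ℕ → SafraTree Q) (m : ℕ) (ρ : ℕ → Q) : Prop :=
  (∀ i ≤ m, ρ i ∈ (t i).σ (t i).root) ∧ ∀ i < m, ρ (i + 1) ∈ A.Δ (ρ i) (w i)

/-- `ρ` visits `F` in each of the first `j` intervals given by `φ`. -/
def Visits (A : NBA Q α) (φ : ℕ → ℕ) (j : ℕ) (ρ : ℕ → Q) : Prop :=
  ∀ i < j, ∃ x ∈ Set.Ico (φ i) (φ (i + 1)), ρ x ∈ A.F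

omit [DecidableEq Q] in
-- Finite runs are total functions constrained only up to `m`, so that they live in the compact
-- space `ℕ → Q`; prolonging one overwrites a single value.
theorem RunUpTo.update {m : ℕ} {ρ : ℕ → Q} (h : RunUpTo A w t m ρ) {s : Q}
    (hs : s ∈ (t (m + 1)).σ (t (m + 1)).root) (hΔ : s ∈ A.Δ (ρ m) (w m)) :
    RunUpTo A w t (m + 1) (Function.update ρ (m + 1) s) := by
  constructor
  · intro i hi
    rcases eq_or_ne i (m + 1) with rfl | hne
    · simpa using hs
    · rw [Function.update_of_ne hne]; exact h.1 i (by omega)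
  · intro i hi
    rw [Function.update_of_ne (show i ≠ m + 1 by omega)]
    rcases eq_or_ne i m with rfl | hne
    · simpa using hΔ
    · rw [Function.update_of_ne (by omega)]; exact h.2 i (by omega)

omit [Fintype Q] [DecidableEq Q] in
theorem Visits.update {φ : ℕ → ℕ} (hφ : StrictMono φ) {j m : ℕ} {ρ : ℕ → Q}
    (h : Visits A φ j ρ) (hm : φ j ≤ m) (s : Q) : Visits A φ j (Function.update ρ (m + 1) s) := by
  intro i hi
  obtain ⟨x, hx, hF⟩ := h i hi
  have h1 : φ (i + 1) ≤ φ j := hφ.monotone hi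
  have h2 : x < φ (i + 1) := hx.2
  exact ⟨x, hx, by rwa [Function.update_of_ne (by omega)]⟩

theorem exists_runUpTo (h : TreeRun A r k w t) (m : ℕ) {s : Q} (hs : s ∈ (t m).σ (t m).root) :
    ∃ ρ, RunUpTo A w t m ρ ∧ ρ m = s := by
  induction m generalizing s with
  | zero =>
    refine ⟨fun _ => s, ⟨fun i hi => ?_, fun i hi => absurd hi (by omega)⟩, rfl⟩
    obtain rfl : i = 0 := by omega
    exact hs
  | succ m ih =>
    obtain ⟨p, hp, hps⟩ := h.exists_pred_root hs
    obtain ⟨ρ, hρ, rfl⟩ := ih hp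
    exact ⟨_, hρ.update hs hps, by simp⟩

theorem mem_root (h : TreeRun A r k w t) {i : ℕ} {v : Label Q} {s : Q} (hv : v ∈ (t i).V)
    (hs : s ∈ (t i).σ v) : s ∈ (t i).σ (t i).root := (h.isState i).subset_root hv hs

theorem childUnion_subset (h : TreeRun A r k w t) (i : ℕ) (v : Label Q) :
    (t i).childUnion v ⊆ (t i).σ v := by
  intro s hs
  obtain ⟨c, hc, hs⟩ := SafraTree.mem_childUnion.1 hs
  exact (h.isState i).nested v c hc hs

/-- From a time at which the node `l` has no children, every state in `l` is reached by a
run through `l`, and every state in a child of `l` by such a run that has visited `F`. -/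
theorem exists_extension (h : TreeRun A r k w t) {l : Label Q} {φ : ℕ → ℕ} (hφ : StrictMono φ)
    (hl : ∀ m, φ 0 ≤ m → l ∈ (t m).V) {j : ℕ} (hleaf : (t (φ j)).childUnion l = ∅)
    (hj : ∀ s ∈ (t (φ j)).σ l, ∃ ρ, RunUpTo A w t (φ j) ρ ∧ Visits A φ j ρ ∧ ρ (φ j) = s)
    {m : ℕ} (hm : φ j ≤ m) :
    (∀ s ∈ (t m).σ l, ∃ ρ, RunUpTo A w t m ρ ∧ Visits A φ j ρ ∧ ρ m = s) ∧
    (∀ s ∈ (t m).childUnion l, ∃ ρ, RunUpTo A w t m ρ ∧ Visits A φ j ρ ∧ ρ m = s ∧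
      ∃ x ∈ Set.Ico (φ j) m, ρ x ∈ A.F) ∧
    ((t (m + 1)).χ l = Colour.Green → ∀ s ∈ (t (m + 1)).σ l,
      ∃ ρ, RunUpTo A w t (m + 1) ρ ∧ Visits A φ j ρ ∧ ρ (m + 1) = s ∧
      ∃ x ∈ Set.Ico (φ j) (m + 1), ρ x ∈ A.F) := by
  have hl' : ∀ m, φ j ≤ m → l ∈ (t m).V := fun m hm =>
    hl m ((hφ.monotone (Nat.zero_le j)).trans hm)
  -- The predecessor is either in a child of `l`, where a visit to `F` has already occurred, or is
  -- itself an accepting state in `l`, and then the visit is at time `m`.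
  have hstep : ∀ m, φ j ≤ m →
      (∀ s ∈ (t m).σ l, ∃ ρ, RunUpTo A w t m ρ ∧ Visits A φ j ρ ∧ ρ m = s) →
      (∀ s ∈ (t m).childUnion l, ∃ ρ, RunUpTo A w t m ρ ∧ Visits A φ j ρ ∧ ρ m = s ∧
        ∃ x ∈ Set.Ico (φ j) m, ρ x ∈ A.F) →
      ∀ s, (s ∈ (t (m + 1)).childUnion l ∨
        ((t (m + 1)).χ l = Colour.Green ∧ s ∈ (t (m + 1)).σ l)) →
      ∃ ρ, RunUpTo A w t (m + 1) ρ ∧ Visits A φ j ρ ∧ ρ (m + 1) = s ∧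
        ∃ x ∈ Set.Ico (φ j) (m + 1), ρ x ∈ A.F := by
    intro m hm h1 h2 s hs
    have hsl : s ∈ (t (m + 1)).σ l :=
      hs.elim (fun h' => h.childUnion_subset _ _ h') (fun h' => h'.2)
    have hsr := h.mem_root (hl' (m + 1) (by omega)) hsl
    obtain ⟨p, hps, hp | ⟨hp, hF⟩⟩ :=
      h.exists_pred_of_mem_childUnion (hl' m hm) (hl' (m + 1) (by omega)) hs
    · obtain ⟨ρ, hρ, hv, rfl, x, hx, hxF⟩ := h2 p hp
      have := hx.2
      exact ⟨_, hρ.update hsr hps, hv.update hφ hm s, by simp, x, ⟨hx.1, by omega⟩,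
        by rwa [Function.update_of_ne (by omega)]⟩
    · obtain ⟨ρ, hρ, hv, rfl⟩ := h1 p hp
      exact ⟨_, hρ.update hsr hps, hv.update hφ hm s, by simp, m, ⟨hm, by omega⟩,
        by rwa [Function.update_of_ne (by omega)]⟩
  have hmain : (∀ s ∈ (t m).σ l, ∃ ρ, RunUpTo A w t m ρ ∧ Visits A φ j ρ ∧ ρ m = s) ∧
      (∀ s ∈ (t m).childUnion l, ∃ ρ, RunUpTo A w t m ρ ∧ Visits A φ j ρ ∧ ρ m = s ∧
        ∃ x ∈ Set.Ico (φ j) m, ρ x ∈ A.F) := by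
    induction m, hm using Nat.le_induction with
    | base => exact ⟨hj, by simp [hleaf]⟩
    | succ m hm ih =>
      refine ⟨fun s hs => ?_, fun s hs => hstep m hm ih.1 ih.2 s (Or.inl hs)⟩
      obtain ⟨p, hp, hps⟩ := h.exists_pred (hl' m hm) (hl' (m + 1) (by omega)) hs
      obtain ⟨ρ, hρ, hv, rfl⟩ := ih.1 p hp
      exact ⟨_, hρ.update (h.mem_root (hl' (m + 1) (by omega)) hs) hps, hv.update hφ hm s,
        by simp⟩
  exact ⟨hmain.1, hmain.2, fun hg s hs => hstep m hm hmain.1 hmain.2 s (Or.inr ⟨hg, hs⟩)⟩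

omit [DecidableEq Q] in
theorem isClosed_runUpTo [TopologicalSpace Q] [DiscreteTopology Q] (m : ℕ) :
    IsClosed {ρ | RunUpTo A w t m ρ} := by
  have h : {ρ | RunUpTo A w t m ρ} =
      (⋂ i ∈ Set.Iic m, (fun ρ : ℕ → Q => ρ i) ⁻¹' {q | q ∈ (t i).σ (t i).root}) ∩
      ⋂ i ∈ Set.Iio m, (fun ρ : ℕ → Q => (ρ i, ρ (i + 1))) ⁻¹' {p | p.2 ∈ A.Δ p.1 (w i)} := by
    ext ρ
    simp [RunUpTo]
  rw [h]
  refine (isClosed_biInter fun i _ => ?_).inter (isClosed_biInter fun i _ => ?_)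
  · exact (isClosed_discrete _).preimage (continuous_apply i)
  · exact (isClosed_discrete _).preimage ((continuous_apply i).prodMk (continuous_apply (i + 1)))

omit [Fintype Q] [DecidableEq Q] in
theorem isClosed_visits [TopologicalSpace Q] [DiscreteTopology Q] (φ : ℕ → ℕ) (j : ℕ) :
    IsClosed {ρ | Visits A φ j ρ} := by
  have h : {ρ | Visits A φ j ρ} = ⋂ i ∈ Set.Iio j, ⋃ x ∈ Set.Ico (φ i) (φ (i + 1)),
      (fun ρ : ℕ → Q => ρ x) ⁻¹' {q | q ∈ A.F} := by
    ext ρ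
    simp [Visits]
  rw [h]
  refine isClosed_biInter fun i _ => Set.Finite.isClosed_biUnion (Set.finite_Ico _ _) fun x _ => ?_
  exact (isClosed_discrete _).preimage (continuous_apply x)

theorem exists_acceptingRun (h : TreeRun A r k w t) {l : Label Q}
    (hG : ∃ᶠ m in atTop, l ∈ (t m).V ∧ (t m).χ l = Colour.Green)
    (hB : ∀ᶠ m in atTop, l ∈ (t m).V) :
    ∃ ρ, A.toOmega.IsAcceptingRun w ρ ∧ ∀ i, ρ i ∈ (t i).σ (t i).root := by
  obtain ⟨N, hN⟩ := eventually_atTop.1 hB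
  -- `φ` enumerates green times after `l` has become permanent.
  obtain ⟨φ, hφ, hφG⟩ := extraction_of_frequently_atTop (hG.and_eventually (eventually_ge_atTop N))
  have hl : ∀ m, φ 0 ≤ m → l ∈ (t m).V := fun m hm => hN m ((hφG 0).2.trans hm)
  have key : ∀ j, ∀ s ∈ (t (φ j)).σ l,
      ∃ ρ, RunUpTo A w t (φ j) ρ ∧ Visits A φ j ρ ∧ ρ (φ j) = s := by
    intro j
    induction j with
    | zero =>
      intro s hs
      obtain ⟨ρ, hρ, hs'⟩ := h.exists_runUpTo (φ 0) (h.mem_root (hl _ le_rfl) hs)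
      exact ⟨ρ, hρ, fun i hi => absurd hi (by omega), hs'⟩
    | succ j ih =>
      have hlt : φ j < φ (j + 1) := hφ (Nat.lt_succ_self j)
      -- The green clause of `exists_extension` speaks about time `m + 1`.
      obtain ⟨m, hm⟩ : ∃ m, φ (j + 1) = m + 1 := ⟨φ (j + 1) - 1, by omega⟩
      intro s hs
      have hg := (hφG (j + 1)).1.2
      have hext := (h.exists_extension hφ hl (h.green_spec (hφG j).1.1 (hφG j).1.2).2 ih
        (m := m) (by omega)).2.2
      rw [← hm] at hext
      obtain ⟨ρ, hρ, hv, hs', hx⟩ := hext hg s hs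
      refine ⟨ρ, hρ, fun i hi => ?_, hs'⟩
      rcases Nat.lt_succ_iff_lt_or_eq.1 hi with hi | rfl
      · exact hv i hi
      · exact hx
  let _ : TopologicalSpace Q := ⊥
  have : DiscreteTopology Q := ⟨rfl⟩
  -- With `Q` finite and discrete, `ℕ → Q` is compact. The sets `C j` are closed, since they
  -- restrict finitely many coordinates, as well as decreasing and nonempty.
  let C : ℕ → Set (ℕ → Q) := fun j => {ρ | RunUpTo A w t (φ j) ρ} ∩ {ρ | Visits A φ j ρ}
  have hC : (⋂ j, C j).Nonempty := by
    have hcl : ∀ j, IsClosed (C j) := fun j => (isClosed_runUpTo _).inter (isClosed_visits _ _)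
    refine IsCompact.nonempty_iInter_of_sequence_nonempty_isCompact_isClosed C ?_ ?_
      (hcl 0).isCompact hcl
    · intro j ρ hρ
      have hlt : φ j < φ (j + 1) := hφ (Nat.lt_succ_self j)
      exact ⟨⟨fun i hi => hρ.1.1 i (by omega), fun i hi => hρ.1.2 i (by omega)⟩,
        fun i hi => hρ.2 i (by omega)⟩
    · intro j
      obtain ⟨s, hs⟩ := (h.green_spec (hφG j).1.1 (hφG j).1.2).1
      obtain ⟨ρ, h1, h2, _⟩ := key j s hs
      exact ⟨ρ, h1, h2⟩
  obtain ⟨ρ, hρ⟩ := hC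
  have hρ' : ∀ j, ρ ∈ C j := Set.mem_iInter.1 hρ
  have hroot : ∀ i, ρ i ∈ (t i).σ (t i).root := fun i => (hρ' i).1.1 i (hφ.id_le i)
  refine ⟨ρ, ⟨⟨?_, fun i => ?_⟩, ?_⟩, hroot⟩
  · have := hroot 0
    rw [h.σ_root_zero] at this
    exact Finset.mem_singleton.1 this
  · have : i + 1 ≤ φ (i + 1) := hφ.id_le (i + 1)
    exact Finset.mem_coe.2 ((hρ' (i + 1)).1.2 i (by omega))
  · refine frequently_atTop.2 fun N => ?_
    obtain ⟨x, hx, hF⟩ := (hρ' (N + 1)).2 N (Nat.lt_succ_self N)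
    exact ⟨x, (hφ.id_le N).trans hx.1, hF⟩

/-! ### Runs of the construction that contain an accepting run of the automaton -/

/-- If a run stays in `v`, which is green only finitely often, then it stays in a child of `v`. -/
theorem exists_persistent_child (h : TreeRun A r k w t) {ρ : ℕ → Q}
    (hρ : A.toOmega.IsAcceptingRun w ρ) {v : Label Q}
    (hv : ∀ᶠ m in atTop, v ∈ (t m).V ∧ ρ m ∈ (t m).σ v)
    (hg : ∀ᶠ m in atTop, (t m).χ v ≠ Colour.Green) :
    ∃ c, ∀ᶠ m in atTop, (t m).Child v c ∧ ρ m ∈ (t m).σ c := by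
  classical
  obtain ⟨M, hM⟩ := eventually_atTop.1 (hv.and hg)
  have hΔ : ∀ i, ρ (i + 1) ∈ A.Δ (ρ i) (w i) := fun i => Finset.mem_coe.1 (hρ.1.2 i)
  have hstep : ∀ m, M ≤ m → ∀ c, (t m).Child v c → ρ m ∈ (t m).σ c →
      ∃ c', (t (m + 1)).Child v c' ∧ ρ (m + 1) ∈ (t (m + 1)).σ c' ∧
        ((t (m + 1)).cl v).idxOf c' ≤ ((t m).cl v).idxOf c ∧
        (c' ≠ c → ((t (m + 1)).cl v).idxOf c' < ((t m).cl v).idxOf c) := by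
    intro m hm c hc hs
    obtain ⟨⟨h1, h2⟩, h3⟩ := hM (m + 1) (by omega)
    obtain ⟨X, hX, hn⟩ := h.step m
    rw [hn] at h1 h2 h3 ⊢
    exact (h.isState m).exists_child_next_of_child A r (w m) X h1 h3 hc hs (hΔ m) h2
  obtain ⟨m₀, hm₀, hF⟩ := frequently_atTop.1 hρ.2 M
  -- A visit to `F` after time `M` puts the run into a child of `v`. A pair of time and child of
  -- least position is then chosen; any later change of child would lower the position further.
  have hex : ∃ n m c, M ≤ m ∧ (t m).Child v c ∧ ρ m ∈ (t m).σ c ∧ ((t m).cl v).idxOf c = n := by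
    obtain ⟨⟨h1, h2⟩, h3⟩ := hM (m₀ + 1) (by omega)
    obtain ⟨X, hX, hn⟩ := h.step m₀
    rw [hn] at h1 h2 h3
    obtain ⟨c, hc, hs⟩ := (h.isState m₀).exists_child_next_of_mem_F A r (w m₀) X (hM m₀ hm₀).1.1
      h1 h3 (hM m₀ hm₀).1.2 hF (hΔ m₀) h2
    rw [← hn] at hc hs
    exact ⟨_, m₀ + 1, c, by omega, hc, hs, rfl⟩
  obtain ⟨m₁, c, hm₁, hc, hs, hidx⟩ := Nat.find_spec hex
  refine ⟨c, eventually_atTop.2 ⟨m₁, fun m hm => ?_⟩⟩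
  have : (t m).Child v c ∧ ρ m ∈ (t m).σ c ∧ ((t m).cl v).idxOf c = Nat.find hex := by
    induction m, hm using Nat.le_induction with
    | base => exact ⟨hc, hs, hidx⟩
    | succ m hm ih =>
      obtain ⟨c', h1, h2, h3, h4⟩ := hstep m (by omega) c ih.1 ih.2.1
      have hmin := Nat.find_min' hex ⟨m + 1, c', by omega, h1, h2, rfl⟩
      by_cases hcc : c' = c
      · subst hcc
        exact ⟨h1, h2, by omega⟩
      · have := h4 hcc
        omega
  exact ⟨this.1, this.2.1⟩

/-- Depth in the tree is replaced by eventual strict inclusion of sets, a transitive irreflexive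
relation on the finitely many labels. A child in which the run settles would lie strictly below the
minimal `v`. -/
theorem accepting_of_acceptingRun (h : TreeRun A r k w t) {ρ : ℕ → Q}
    (hρ : A.toOmega.IsAcceptingRun w ρ) (hroot : ∀ i, ρ i ∈ (t i).σ (t i).root) :
    ∃ l, (∃ᶠ m in atTop, l ∈ (t m).V ∧ (t m).χ l = Colour.Green) ∧
      ∀ᶠ m in atTop, l ∈ (t m).V := by
  let R : Label Q → Label Q → Prop := fun c v => ∀ᶠ m in atTop, (t m).σ c ⊂ (t m).σ v
  have : IsTrans (Label Q) R := ⟨fun a b c hab hbc => by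
    filter_upwards [hab, hbc] with m h1 h2 using h1.trans h2⟩
  have : Std.Irrefl R := ⟨fun a ha => by
    obtain ⟨m, hm⟩ := ha.exists
    exact (ssubset_irrefl _ hm).elim⟩
  have hwf : WellFounded R := Finite.wellFounded_of_trans_of_irrefl R
  obtain ⟨v, hv, hmin⟩ := hwf.has_min
    {v | ∀ᶠ m in atTop, v ∈ (t m).V ∧ ρ m ∈ (t m).σ v}
    ⟨A.firstLabel, Eventually.of_forall fun m =>
      ⟨h.root_eq m ▸ (h.isState m).tree.root_mem, h.root_eq m ▸ hroot m⟩⟩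
  refine ⟨v, ?_, hv.mono fun m hm => hm.1⟩
  by_contra hnot
  have hg : ∀ᶠ m in atTop, (t m).χ v ≠ Colour.Green := by
    filter_upwards [not_frequently.1 hnot, hv] with m h1 h2 h3 using h1 ⟨h2.1, h3⟩
  obtain ⟨c, hc⟩ := h.exists_persistent_child hρ hv hg
  refine hmin c ?_ ?_
  · filter_upwards [hc] with m hm using ⟨((h.isState m).tree.child_mem _ _ hm.1).2, hm.2⟩
  · filter_upwards [hc] with m hm
    refine lt_of_le_of_lt ?_ ((h.isState m).ssubset v ((h.isState m).tree.child_mem _ _ hm.1).1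
      (List.ne_nil_of_mem hm.1))
    exact fun s hs => SafraTree.mem_childUnion.2 ⟨c, hm.1, hs⟩

end TreeRun
end KSafra

/-! ### Language equality, and strategies against resolvers -/

namespace KSafra

open Filter

variable {Q α : Type*} [Fintype Q] [DecidableEq Q]

/-! ### Acceptance by the `k`-Safra construction -/

section Acceptance

variable {A : NBA Q α} {r : LabelRule Q} {k : ℕ} {hk : 1 ≤ k} {w : ℕ → α}
  {τ : ℕ → {t : SafraTree Q // t.IsState k}}

/-- A run of the construction is accepting if and only if the sets of the roots contain an
accepting run of the automaton. -/
theorem mem_acc_iff (h : (A.kSafra r k hk).toOmega.IsRun w τ) :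
    τ ∈ (A.kSafra r k hk).toOmega.Acc ↔
      ∃ ρ, A.toOmega.IsAcceptingRun w ρ ∧ ∀ i, ρ i ∈ (τ i).1.σ (τ i).1.root := by
  constructor
  · rintro ⟨l, hG, hB⟩
    exact (treeRun_of_isRun h).exists_acceptingRun hG
      (hB.mono fun m hm => not_not.1 fun h' => hm h')
  · rintro ⟨ρ, hρ, hroot⟩
    obtain ⟨l, hG, hB⟩ := (treeRun_of_isRun h).accepting_of_acceptingRun hρ hroot
    exact ⟨l, hG, hB.mono fun m hm h' => h' hm⟩

omit [Fintype Q] in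
-- Only the inclusion of `Y` is conditional: a legal choice always exists, which makes `chooseSucc`
-- total.
theorem exists_rootChoice (k : ℕ) (D Y : Finset Q) :
    ∃ X ∈ SafraTree.rootChoices k D, Y ⊆ D → Y.card ≤ k → Y ⊆ X := by
  unfold SafraTree.rootChoices
  simp only [Set.mem_ofPred_eq]
  by_cases hD : D.card ≤ k
  · exact ⟨D, by simp [hD], fun h _ => h⟩
  · simp only [if_neg hD]
    by_cases hY : Y ⊆ D ∧ Y.card ≤ k
    · obtain ⟨X, h1, h2, h3⟩ := Finset.exists_subsuperset_card_eq hY.1 hY.2 (not_le.1 hD).le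
      exact ⟨X, ⟨h2, h3⟩, fun _ _ => h1⟩
    · obtain ⟨X, h1, h2⟩ := Finset.exists_subset_card_eq (not_le.1 hD).le
      exact ⟨X, ⟨h1, h2⟩, fun h h' => absurd ⟨h, h'⟩ hY⟩

variable (A r) in
/-- A successor of a state of the construction whose root contains `Y`, if possible. -/
noncomputable def chooseSucc (t : {t : SafraTree Q // t.IsState k}) (a : α) (Y : Finset Q) :
    {t : SafraTree Q // t.IsState k} :=
  ⟨t.1.next A r a (exists_rootChoice k (A.post (t.1.σ t.1.root) a) Y).choose,
    t.2.next A r a _ (SafraTree.rootChoices_spec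
      (exists_rootChoice k (A.post (t.1.σ t.1.root) a) Y).choose_spec.1).2⟩

theorem chooseSucc_mem (t : {t : SafraTree Q // t.IsState k}) (a : α) (Y : Finset Q) :
    chooseSucc A r t a Y ∈ (A.kSafra r k hk).toOmega.Δ t a :=
  ⟨_, (exists_rootChoice k (A.post (t.1.σ t.1.root) a) Y).choose_spec.1, rfl⟩

theorem subset_chooseSucc {t : {t : SafraTree Q // t.IsState k}} {a : α} {Y : Finset Q}
    (hY : Y ⊆ A.post (t.1.σ t.1.root) a) (hc : Y.card ≤ k) :
    Y ⊆ (chooseSucc A r t a Y).1.σ (chooseSucc A r t a Y).1.root := by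
  have h : (chooseSucc A r t a Y).1.σ (chooseSucc A r t a Y).1.root =
      (exists_rootChoice k (A.post (t.1.σ t.1.root) a) Y).choose := t.2.next_σ_root A r a _
  rw [h]
  exact (exists_rootChoice k (A.post (t.1.σ t.1.root) a) Y).choose_spec.2 hY hc

theorem kSafra_lang (A : NBA Q α) (r : LabelRule Q) (k : ℕ) (hk : 1 ≤ k) :
    (A.kSafra r k hk).toOmega.lang = A.toOmega.lang := by
  ext w
  constructor
  · rintro ⟨τ, hτ, hacc⟩
    obtain ⟨ρ, hρ, _⟩ := (mem_acc_iff hτ).1 hacc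
    exact ⟨ρ, hρ⟩
  · rintro ⟨ρ, hρ⟩
    -- The next state of `ρ` is forced into each root set; one state fits because `1 ≤ k`.
    let τ : ℕ → {t : SafraTree Q // t.IsState k} := fun i => Nat.rec (A.kSafra r k hk).start
      (fun i t => chooseSucc A r t (w i) {ρ (i + 1)}) i
    have hτ : (A.kSafra r k hk).toOmega.IsRun w τ := ⟨rfl, fun i => chooseSucc_mem _ _ _⟩
    refine ⟨τ, hτ, (mem_acc_iff hτ).2 ⟨ρ, hρ, fun i => ?_⟩⟩
    induction i with
    | zero =>
      have h0 := (treeRun_of_isRun hτ).σ_root_zero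
      rw [h0, hρ.1.1]
      exact Finset.mem_singleton_self _
    | succ i ih =>
      refine subset_chooseSucc (r := r) (t := τ i) (a := w i) (Y := {ρ (i + 1)}) ?_ (by simpa)
        (Finset.mem_singleton_self _)
      exact Finset.singleton_subset_iff.2
        (NBA.mem_post.2 ⟨ρ i, ih, Finset.mem_coe.1 (hρ.1.2 i)⟩)

end Acceptance

/-! ### The width game -/

theorem takePrefix_succ (w : ℕ → α) (i : ℕ) : OmegaAutomaton.takePrefix w (i + 1) =
    OmegaAutomaton.takePrefix w i ++ [w i] := by
  simp [OmegaAutomaton.takePrefix, List.range_succ]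

omit [Fintype Q] [DecidableEq Q] in
theorem widthGame_edge_inr {A : OmegaAutomaton Q α} {k : ℕ} {hk : 1 ≤ k} {X : SubsetsLE Q k}
    {a : α} {v : SubsetsLE Q k ⊕ (SubsetsLE Q k × α)}
    (h : (widthGame A k hk).E (Sum.inr (X, a)) v) :
    ∃ Y : SubsetsLE Q k, v = Sum.inl Y ∧ ∀ q ∈ Y.1, ∃ p ∈ X.1, q ∈ A.Δ p a := by
  cases v with
  | inl Y => exact ⟨Y, rfl, h⟩
  | inr Y => exact h.elim

/-- With `|Q|` tokens, Player `0` can keep all the reachable states. -/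
theorem player0Wins_card (A : NBA Q α) (hk : 1 ≤ Fintype.card Q) :
    (widthGame A.toOmega (Fintype.card Q) hk).Player0Wins := by
  refine ⟨⟨fun _ v => match v with
    | Sum.inl X => Sum.inl X
    | Sum.inr (X, a) => Sum.inl ⟨A.post X.1 a, Finset.card_le_univ _⟩, ?_⟩, ?_⟩
  · rintro h _ ⟨⟨X, a⟩, rfl⟩ q hq
    exact NBA.mem_post.1 hq
  · intro π hπ hcons X w hX ⟨ρ, hρ⟩
    refine ⟨ρ, hρ, fun i => ?_⟩
    induction i with
    | zero =>
      have h0 := (hX 0).1.symm.trans hπ.1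
      rw [Sum.inl.inj h0, hρ.1.1]
      exact Finset.mem_singleton_self _
    | succ i ih =>
      have h1 := hcons (2 * i + 1) ⟨_, (hX i).2.symm⟩
      rw [(hX i).2] at h1
      have h2 := (hX (i + 1)).1.symm.trans h1
      rw [Sum.inl.inj h2]
      exact NBA.mem_post.2 ⟨ρ i, ih, Finset.mem_coe.1 (hρ.1.2 i)⟩

/-! ### From width to good-for-games -/

section WidthToGFG

variable {A : NBA Q α} (r : LabelRule Q) {k k₀ : ℕ} {hk₀ : 1 ≤ k₀} (hk : 1 ≤ k)
  (s : (widthGame A.toOmega k₀ hk₀).Strategy0)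

/-- The history of a play of the width game, its current position, and a state of the
construction. -/
abbrev Config (Q α : Type*) [Fintype Q] [DecidableEq Q] (k k₀ : ℕ) :=
  List (SubsetsLE Q k₀ ⊕ (SubsetsLE Q k₀ × α)) × SubsetsLE Q k₀ × {t : SafraTree Q // t.IsState k}

/-- The answer of Player `0` to the letter `a`. -/
def answer (c : Config Q α k k₀) (a : α) : SubsetsLE Q k₀ :=
  Sum.elim id Prod.fst (s.move (c.1 ++ [Sum.inl c.2.1]) (Sum.inr (c.2.1, a)))

/-- The recorded history stops just before the current position, so each letter appends two
positions. -/
noncomputable def Config.next (c : Config Q α k k₀) (a : α) : Config Q α k k₀ :=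
  (c.1 ++ [Sum.inl c.2.1, Sum.inr (c.2.1, a)], answer s c a,
    chooseSucc A r c.2.2 a (answer s c a).1)

noncomputable def Config.ofList (l : List α) : Config Q α k k₀ :=
  l.foldl (Config.next r s)
    ([], ⟨{A.start}, by simpa using hk₀⟩, (A.kSafra r k hk).start)

theorem ofList_succ (w : ℕ → α) (i : ℕ) :
    Config.ofList r hk s (OmegaAutomaton.takePrefix w (i + 1)) =
      Config.next r s (Config.ofList r hk s (OmegaAutomaton.takePrefix w i)) (w i) := by
  simp [Config.ofList, takePrefix_succ]

/-- A legal move of Player `0` is never of the form `Sum.inr`, so the `Prod.fst` branch of `answer`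
plays no role. -/
theorem answer_spec (c : Config Q α k k₀) (a : α) :
    s.move (c.1 ++ [Sum.inl c.2.1]) (Sum.inr (c.2.1, a)) = Sum.inl (answer s c a) ∧
      (answer s c a).1 ⊆ A.post c.2.1.1 a := by
  obtain ⟨Y, hY, hΔ⟩ := widthGame_edge_inr (s.edge (c.1 ++ [Sum.inl c.2.1])
    (Sum.inr (c.2.1, a)) ⟨_, rfl⟩)
  have : answer s c a = Y := by rw [answer, hY]; rfl
  rw [this]
  exact ⟨hY, fun q hq => NBA.mem_post.2 (hΔ q hq)⟩

/-- A winning strategy in the width game with at most `k` tokens resolves the nondeterminism of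
the `k`-Safra construction. -/
theorem isGFG_of_winning (hkk : k₀ ≤ k) (hs : ∀ π, (widthGame A.toOmega k₀ hk₀).IsPlay π →
    s.Consistent π → π ∈ (widthGame A.toOmega k₀ hk₀).W) : (A.kSafra r k hk).toOmega.IsGFG := by
  refine ⟨fun l => (Config.ofList r hk s l).2.2, fun w => ?_⟩
  let c : ℕ → Config Q α k k₀ := fun i => Config.ofList r hk s (OmegaAutomaton.takePrefix w i)
  have hc : ∀ i, c (i + 1) = Config.next r s (c i) (w i) := ofList_succ r hk s w
  have hrun : (A.kSafra r k hk).toOmega.IsRun w (fun i => (c i).2.2) := by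
    refine ⟨rfl, fun i => ?_⟩
    dsimp only
    rw [hc i]
    exact chooseSucc_mem _ _ _
  refine ⟨hrun, fun hw => ⟨hrun, ?_⟩⟩
  rw [kSafra_lang] at hw
  let π : ℕ → SubsetsLE Q k₀ ⊕ (SubsetsLE Q k₀ × α) := fun n =>
    if n % 2 = 0 then Sum.inl (c (n / 2)).2.1 else Sum.inr ((c (n / 2)).2.1, w (n / 2))
  have hπ0 : ∀ i, π (2 * i) = Sum.inl (c i).2.1 := by
    intro i
    simp [π]
  have hπ1 : ∀ i, π (2 * i + 1) = Sum.inr ((c i).2.1, w i) := by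
    intro i
    have h1 : (2 * i + 1) % 2 = 1 := by omega
    have h2 : (2 * i + 1) / 2 = i := by omega
    simp [π, h1, h2]
  -- The simulated history is that of the play `π`; this is what makes `π` consistent with the
  -- strategy.
  have hhist : ∀ i, (List.range (2 * i)).map π = (c i).1 := by
    intro i
    induction i with
    | zero => rfl
    | succ i ih =>
      rw [hc i, show 2 * (i + 1) = 2 * i + 1 + 1 by ring, List.range_succ, List.range_succ]
      simp [ih, hπ0, hπ1, Config.next]
  have hmove : ∀ i, π (2 * i + 1 + 1) =
      s.move ((List.range (2 * i + 1)).map π) (π (2 * i + 1)) := by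
    intro i
    rw [show 2 * i + 1 + 1 = 2 * (i + 1) by ring, hπ0, hπ1, List.range_succ, List.map_append,
      hhist, List.map_singleton, hπ0, (answer_spec s (c i) (w i)).1, hc i]
    rfl
  have hplay : (widthGame A.toOmega k₀ hk₀).IsPlay π := by
    refine ⟨rfl, fun n => ?_⟩
    rcases Nat.even_or_odd' n with ⟨i, rfl | rfl⟩
    · rw [hπ0, hπ1]; rfl
    · rw [hmove]
      exact s.edge _ _ ⟨_, (hπ1 i).symm⟩
  have hcons : s.Consistent π := by
    intro n hn
    rcases Nat.even_or_odd' n with ⟨i, rfl | rfl⟩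
    · obtain ⟨x, hx⟩ := hn
      rw [hπ0] at hx
      simp at hx
    · exact hmove i
  obtain ⟨ρ, hρ, hin⟩ := hs π hplay hcons (fun i => (c i).2.1) w (fun i => ⟨hπ0 i, hπ1 i⟩) hw
  refine (mem_acc_iff hrun).2 ⟨ρ, hρ, fun i => ?_⟩
  -- Invariant: the tokens are contained in the root set.
  have hsub : ∀ i, (c i).2.1.1 ⊆ (c i).2.2.1.σ (c i).2.2.1.root := by
    intro i
    induction i with
    | zero =>
      have h0 := (treeRun_of_isRun hrun).σ_root_zero
      rw [h0]
      exact subset_rfl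
    | succ i ih =>
      rw [hc i]
      exact subset_chooseSucc (((answer_spec s (c i) (w i)).2).trans (A.post_mono ih _))
        ((answer s (c i) (w i)).2.trans hkk)
  exact hsub i (hin i)

end WidthToGFG

/-! ### From good-for-games to width -/

/-- The letters chosen by Player `1` in a history of the width game. -/
def letters {β : Type*} (h : List (β ⊕ (β × α))) : List α :=
  h.filterMap (Sum.elim (fun _ => none) (fun p => some p.2))

theorem letters_history {β : Type*} {π : ℕ → β ⊕ (β × α)} {X : ℕ → β} {w : ℕ → α}
    (hX : ∀ i, π (2 * i) = Sum.inl (X i) ∧ π (2 * i + 1) = Sum.inr (X i, w i)) (i : ℕ) :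
    letters ((List.range (2 * i + 1)).map π) = OmegaAutomaton.takePrefix w i := by
  induction i with
  | zero =>
    have h0 := (hX 0).1
    simp only [mul_zero] at h0
    simp [letters, OmegaAutomaton.takePrefix, h0]
  | succ i ih =>
    rw [takePrefix_succ, ← ih, show 2 * (i + 1) + 1 = 2 * i + 1 + 1 + 1 by ring,
      List.range_succ, List.range_succ (n := 2 * i + 1)]
    have h0 : π (2 * i + 1 + 1) = Sum.inl (X (i + 1)) := (hX (i + 1)).1
    simp [letters, h0, (hX i).2]

open Classical in
-- Player `0` recovers the word from the history and plays the root set of the state that the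
-- resolver assigns to it.
theorem player0Wins_of_isGFG {A : NBA Q α} {r : LabelRule Q} {k : ℕ} {hk : 1 ≤ k}
    (h : (A.kSafra r k hk).toOmega.IsGFG) : (widthGame A.toOmega k hk).Player0Wins := by
  obtain ⟨f, hf⟩ := h
  let Z : List α → SubsetsLE Q k := fun l =>
    ⟨(f l).1.σ (f l).1.root, (f l).2.card_le _ (f l).2.tree.root_mem⟩
  refine ⟨⟨fun h v => match v with
    | Sum.inl X => Sum.inl X
    -- A strategy must be legal at every position with every history; the empty set is the move
    -- where the root set is not available. By `hXZ` this never happens in the plays considered.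
    | Sum.inr (X, a) => if (Z (letters h ++ [a])).1 ⊆ A.post X.1 a
        then Sum.inl (Z (letters h ++ [a])) else Sum.inl ⟨∅, by simp⟩, ?_⟩, ?_⟩
  · rintro h _ ⟨⟨X, a⟩, rfl⟩
    dsimp only
    split_ifs with hZ
    · exact fun q hq => NBA.mem_post.1 (hZ hq)
    · exact fun q hq => absurd hq (Finset.notMem_empty q)
  · intro π hπ hcons X w hX hw
    have hrun := (hf w).1
    have htree := treeRun_of_isRun hrun
    have hXZ : ∀ i, X i = Z (OmegaAutomaton.takePrefix w i) := by
      intro i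
      induction i with
      | zero =>
        rw [Sum.inl.inj ((hX 0).1.symm.trans hπ.1)]
        exact Subtype.ext htree.σ_root_zero.symm
      | succ i ih =>
        have h1 := hcons (2 * i + 1) ⟨_, (hX i).2.symm⟩
        rw [(hX i).2] at h1
        dsimp only at h1
        rw [letters_history hX, ← takePrefix_succ, if_pos] at h1
        · exact Sum.inl.inj ((hX (i + 1)).1.symm.trans h1)
        · rw [ih]
          exact fun q hq => NBA.mem_post.2 (htree.exists_pred_root hq)
    rw [← kSafra_lang A r k hk] at hw
    obtain ⟨ρ, hρ, hin⟩ := (mem_acc_iff hrun).1 ((hf w).2 hw).2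
    exact ⟨ρ, hρ, fun i => by rw [hXZ i]; exact hin i⟩

theorem width_le_iff (A : NBA Q α) (r : LabelRule Q) (k : ℕ) (hk : 1 ≤ k) :
    A.toOmega.width ≤ k ↔ (A.kSafra r k hk).toOmega.IsGFG := by
  constructor
  · intro h
    have hQ : 1 ≤ Fintype.card Q := Fintype.card_pos_iff.2 ⟨A.start⟩
    -- The infimum is attained because `Fintype.card Q` tokens suffice. It may be smaller than `k`;
    -- `isGFG_of_winning` allows this, so no monotonicity of the game in `k` is needed.
    obtain ⟨hk₀, s, hs⟩ := Nat.sInf_mem (s := {k | ∃ hk : 1 ≤ k,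
      (widthGame A.toOmega k hk).Player0Wins}) ⟨_, hQ, player0Wins_card A hQ⟩
    exact isGFG_of_winning r hk s h hs
  · intro h
    exact Nat.sInf_le ⟨hk, player0Wins_of_isGFG h⟩

end KSafra

theorem mainTheorem7 {Q α : Type*} [Fintype Q] [DecidableEq Q] (A : KSafra.NBA Q α)
    (r : KSafra.LabelRule Q) (k : ℕ) (hk : 1 ≤ k) :
    (A.kSafra r k hk).toOmega.lang = A.toOmega.lang ∧
      (A.toOmega.width ≤ k ↔ (A.kSafra r k hk).toOmega.IsGFG) :=
  ⟨KSafra.kSafra_lang A r k hk, KSafra.width_le_iff A r k hk⟩
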